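/- Let $q$ be a prime power, $n\ge 0$ an integer, and $V=\mathbb F_q^n$ the standard $GL_n(q)$-module with standard basis $x_1,\dots,x_n$. Identify $S(V)=\mathbb F_q[x_1,\dots,x_n]$ and $\wedge(V)=E[y_1,\dots,y_n]$ (where $y_t$ is $x_t$ regarded in $\wedge^1(V)=V$), so that $g\in GL_n(q)$ acts by algebra automorphisms with $g\cdot x_j=\sum_k g_{kj}x_k$ and $g\cdot y_j=\sum_k g_{kj}y_k$. Let $I=(n_1,\dots,n_\ell)$ be a composition of $n$ with all $n_i\ge 1$, and put $m_0=0$, $m_i=n_1+\cdots+n_i$. Let $K_I\subset GL_n(q)$ be the group of block upper triangular matrices with diagonal blocks $A_i\in SL_{n_i}(q)$, $1\le i\le \ell$. Notation. For $m\ge 0$ let $$L_m(x_1,\dots,x_m)=\prod_{k=1}^m\ \prod_{c_1,\dots,c_{k-1}\in\mathbb F_q}(c_1x_1+\cdots+c_{k-1}x_{k-1}+x_k),$$ and for $0\le k\le m$ let $L_{m,k}(x_1,\dots,x_m)$ be the determinant of the $m\times m$ matrix with rows $(x_1^{q^e},\dots,x_m^{q^e})$, $e\in\{0,\dots,m\}\setminus\{k\}$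 in increasing order. Then $L_m$ divides $L_{m,k}$ in $\mathbb F_q[x_1,\dots,x_m]$; put $Q_{m,k}=L_{m,k}/L_m$. For $1\le i\le\ell$ and $1\le j\le n_i$ let $$v_{i,j}=\prod_{c_1,\dots,c_{m_{i-1}}\in\mathbb F_q}(c_1x_1+\cdots+c_{m_{i-1}}x_{m_{i-1}}+x_{m_{i-1}+j}),$$ and set $\theta_i=L_{n_i}(v_{i,1},\dots,v_{i,n_i})$ and $q_{i,k}=Q_{n_i,k}(v_{i,1},\dots,v_{i,n_i})$ for $1\le k\le n_i-1$. For $1\le j\le m\le n$ and $0\le b_1<\cdots<b_j\le m-1$ let $$M_{m;b_1,\dots,b_j}=\frac1{j!}\det(N)\in S(V)\otimes\wedge(V),$$ where $N$ is the $m\times m$ matrix whose first $j$ rows all equal $(y_1,\dots,y_m)$ and whose remaining rows are $(x_1^{q^e},\dots,x_m^{q^e})$ for $e\in\{0,\dots,m-1\}\setminus\{b_1,\dots,b_j\}$ in increasing order, and $\det(N)=\sum_{\sigma\in S_m}\operatorname{sgn}(\sigma)N_{1\sigma(1)}\cdots N_{m\sigma(m)}$ is the row determinant. The factor $\frac1{j!}$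 is understood integrally (division by $j!$ over $\mathbb Z$, followed by reduction to $\mathbb F_q$): since the terms of $\sigma$ and $\sigma\pi$ agree for each permutation $\pi$ of the first $j$ rows, $M_{m;b_1,\dots,b_j}$ is the sum of the terms with $\sigma(1)<\cdots<\sigma(j)$. Theorem. (1) The $n$ elements $\theta_i$ $(1\le i\le \ell)$ and $q_{i,k}$ $(1\le i\le\ell,\ 1\le k\le n_i-1)$ are algebraically independent over $\mathbb F_q$ and generate the algebra $S(V)^{K_I}$. Thus $S(V)^{K_I}$ is the polynomial algebra $$S(V)^{K_I}=\mathbb F_q[\theta_1,q_{1,1},\dots,q_{1,n_1-1},\ \dots,\ \theta_\ell,q_{\ell,1},\dots,q_{\ell,n_\ell-1}].$$ (2) $(S(V)\otimes\wedge(V))^{K_I}$ is a free $S(V)^{K_I}$-module, with basis consisting of $1$ and the elements $M_{m_i;b_1,\dots,b_j}$ for $1\le i\le\ell$, $1\le j\le m_i$, $0\le b_1<\cdots<b_j\le m_i-1$ and $b_j\ge m_{i-1}$. That is, $$(S(V)\otimes\wedge(V))^{K_I}=S(V)^{K_I}\oplus\bigoplus_{j=1}^n\ \bigoplus_{\substack{1\le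 i\le\ell\\ m_i\ge j}}\ \bigoplus_{\substack{0\le b_1<\cdots<b_j\le m_i-1\\ b_j\ge m_{i-1}}}M_{m_i;b_1,\dots,b_j}\,S(V)^{K_I},$$ where every summand is free of rank one on the displayed generator. -/

import Mathlib

open scoped TensorProduct

namespace DicksonMui

noncomputable section

/-! ### Products of linear forms and Dickson polynomials -/

section Dickson

set_option linter.unusedSectionVars false

variable (F : Type*) [Field F] [Fintype F]

/-- `V_{k+1}(u) = ∏_{c} (c_1 u_1 + ⋯ + c_k u_k + u_{k+1})`, the product over all `c ∈ F^k`
(the index `k` is counted from `0`). -/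
def prodV {A : Type*} [CommRing A] [Algebra F A] {m : ℕ} (u : Fin m → A) (k : Fin m) : A :=
  ∏ c : Fin k → F, (∑ t : Fin k, c t • u (Fin.castLE k.2.le t) + u k)

/-- `L_m(u_1, …, u_m) = V_1 V_2 ⋯ V_m`. -/
def prodL {A : Type*} [CommRing A] [Algebra F A] {m : ℕ} (u : Fin m → A) : A :=
  ∏ k : Fin m, prodV F u k

/-- `L_{m,k}` in `F[x_1, …, x_m]`: the determinant whose rows are
`(x_1^(q^e), …, x_m^(q^e))`, `e = 0, …, m`, with the row `e = k` omitted. -/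
def detL (m : ℕ) (k : Fin (m + 1)) : MvPolynomial (Fin m) F :=
  (Matrix.of fun r c : Fin m =>
    (MvPolynomial.X c : MvPolynomial (Fin m) F) ^ Fintype.card F ^ (k.succAbove r : ℕ)).det

/-- Coefficients of the linear form `c_1 x_1 + ⋯ + c_k x_k + x_{k+1}`. -/
def linCoeff {m : ℕ} (p : Σ k : Fin m, (Fin k → F)) (t : Fin m) : F :=
  if h : (t : ℕ) < p.1 then p.2 ⟨t, h⟩ else if t = p.1 then 1 else 0

def linForm {m : ℕ} (p : Σ k : Fin m, (Fin k → F)) : MvPolynomial (Fin m) F :=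
  ∑ t : Fin p.1, p.2 t • MvPolynomial.X (Fin.castLE p.1.2.le t) + MvPolynomial.X p.1

theorem linForm_eq {m : ℕ} (p : Σ k : Fin m, (Fin k → F)) :
    linForm F p = ∑ t, linCoeff F p t • (MvPolynomial.X t : MvPolynomial (Fin m) F) := by
  classical
  obtain ⟨k, c⟩ := p
  have hsplit : ∀ t : Fin m, linCoeff F ⟨k, c⟩ t • (MvPolynomial.X t : MvPolynomial (Fin m) F) =
      (if h : (t : ℕ) < k then c ⟨t, h⟩ • (MvPolynomial.X t : MvPolynomial (Fin m) F) else 0) +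
      (if t = k then MvPolynomial.X t else 0) := by
    intro t
    unfold linCoeff
    by_cases h : (t : ℕ) < k
    · have : t ≠ k := by rintro rfl; exact lt_irrefl _ h
      simp [h, this]
    · by_cases h' : t = k
      · subst h'; simp
      · simp [h, h']
  simp_rw [hsplit]
  rw [Finset.sum_add_distrib]
  simp only [Finset.sum_ite_eq', Finset.mem_univ, if_true, linForm]
  congr 1
  symm
  rw [← Finset.sum_subset (Finset.subset_univ
    (Finset.univ.map (Fin.castLEEmb k.2.le))), Finset.sum_map]
  · refine Finset.sum_congr rfl fun t _ => ?_
    simp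
  · intro t _ ht
    rw [dif_neg]
    intro h
    exact ht (Finset.mem_map.2 ⟨⟨t, h⟩, Finset.mem_univ _, by ext; simp⟩)

theorem linForm_eq_sumSMulX {m : ℕ} (p : Σ k : Fin m, (Fin k → F)) :
    linForm F p = MvPolynomial.sumSMulX (Finsupp.equivFunOnFinite.symm (linCoeff F p)) := by
  rw [linForm_eq, MvPolynomial.sumSMulX, Finsupp.linearCombination_apply,
    Finsupp.sum_fintype _ _ (by simp)]
  simp

theorem coeff_linForm {m : ℕ} (p : Σ k : Fin m, (Fin k → F)) (t : Fin m) :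
    (linForm F p).coeff (Finsupp.single t 1) = linCoeff F p t := by
  rw [linForm_eq_sumSMulX, MvPolynomial.coeff_sumSMulX]
  simp

theorem linCoeff_self {m : ℕ} (p : Σ k : Fin m, (Fin k → F)) :
    linCoeff F p p.1 = 1 := by
  simp [linCoeff]

theorem linCoeff_gt {m : ℕ} (p : Σ k : Fin m, (Fin k → F)) (t : Fin m) (h : p.1 < t) :
    linCoeff F p t = 0 := by
  have h1 : ¬ (t : ℕ) < p.1 := by have : (p.1 : ℕ) < t := h; omega
  simp [linCoeff, h1, h.ne']

theorem irreducible_linForm {m : ℕ} (p : Σ k : Fin m, (Fin k → F)) :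
    Irreducible (linForm F p) := by
  rw [linForm_eq_sumSMulX]
  apply MvPolynomial.irreducible_sumSMulX
  · exact ⟨p.1, by simp [linCoeff_self]⟩
  · intro r hr
    have := hr p.1
    simp only [Finsupp.equivFunOnFinite_symm_apply_apply, linCoeff_self] at this
    exact isUnit_of_dvd_one this

theorem linForm_isRelPrime {m : ℕ} (p p' : Σ k : Fin m, (Fin k → F)) (hne : p ≠ p') :
    IsRelPrime (linForm F p) (linForm F p') := by
  rw [(irreducible_linForm F p).isRelPrime_iff_not_dvd]
  intro hdvd
  obtain ⟨w, hw⟩ := (irreducible_linForm F p).associated_of_dvd (irreducible_linForm F p') hdvd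
  obtain ⟨r, hr⟩ : ∃ r : F, (w : MvPolynomial (Fin m) F) = MvPolynomial.C r :=
    ⟨_, MvPolynomial.totalDegree_eq_zero_iff_eq_C.1
      (MvPolynomial.isUnit_iff_totalDegree_of_isReduced.1 w.isUnit).2⟩
  have hcoef : ∀ t, linCoeff F p t * r = linCoeff F p' t := by
    intro t
    rw [← coeff_linForm, ← coeff_linForm, ← hw, hr, mul_comm _ (MvPolynomial.C r),
      MvPolynomial.coeff_C_mul, mul_comm]
  have hr0 : r ≠ 0 := by
    rintro rfl
    have := hcoef p'.1
    simp [linCoeff_self] at this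
  have hk : p.1 = p'.1 := by
    rcases lt_trichotomy p.1 p'.1 with h | h | h
    · have := hcoef p'.1
      simp [linCoeff_self, linCoeff_gt F p _ h] at this
    · exact h
    · have := hcoef p.1
      rw [linCoeff_self, linCoeff_gt F p' _ h] at this
      simp [hr0] at this
  obtain ⟨k, c⟩ := p
  obtain ⟨k', c'⟩ := p'
  obtain rfl : k = k' := hk
  have hr1 : r = 1 := by simpa [linCoeff] using hcoef k
  subst hr1
  apply hne
  congr 1
  funext t
  have h1 : ((Fin.castLE k.2.le t : Fin m) : ℕ) < k := t.2
  have := hcoef (Fin.castLE k.2.le t)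
  simpa [linCoeff] using this

theorem linForm_dvd_detL {m : ℕ} (e : Fin (m + 1)) (p : Σ k : Fin m, (Fin k → F)) :
    linForm F p ∣ detL F m e := by
  have hprime : Prime (linForm F p) := (irreducible_linForm F p).prime
  have : (Ideal.span {linForm F p}).IsPrime :=
    (Ideal.span_singleton_prime hprime.ne_zero).2 hprime
  rw [← Ideal.mem_span_singleton, ← Ideal.Quotient.eq_zero_iff_mem, detL, RingHom.map_det]
  apply Matrix.exists_mulVec_eq_zero_iff.1
  refine ⟨fun t => algebraMap F _ (linCoeff F p t), ?_, ?_⟩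
  · intro h
    have := congrFun h p.1
    simp [linCoeff_self] at this
  · funext r
    have h0 : Ideal.Quotient.mk (Ideal.span {linForm F p}) (linForm F p) = 0 :=
      Ideal.Quotient.eq_zero_iff_mem.2 (Ideal.mem_span_singleton_self _)
    have hfrob := map_sum ((FiniteField.frobeniusAlgHom F (MvPolynomial (Fin m) F)) ^
      (e.succAbove r : ℕ)) (fun t => linCoeff F p t • MvPolynomial.X t) Finset.univ
    rw [← linForm_eq] at hfrob
    have hpow : ∀ (s : ℕ) (a : MvPolynomial (Fin m) F),
        ((FiniteField.frobeniusAlgHom F (MvPolynomial (Fin m) F)) ^ s) a =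
          a ^ Fintype.card F ^ s := by
      intro s a
      rw [AlgHom.coe_pow, FiniteField.coe_frobeniusAlgHom, pow_iterate]
    have hterm : ∀ t, (linCoeff F p t • (MvPolynomial.X t : MvPolynomial (Fin m) F)) ^
        Fintype.card F ^ (e.succAbove r : ℕ) = MvPolynomial.X t ^
        Fintype.card F ^ (e.succAbove r : ℕ) * algebraMap F _ (linCoeff F p t) := by
      intro t
      rw [← hpow, map_smul, hpow, Algebra.smul_def, mul_comm]
    simp only [hpow, hterm] at hfrob
    have h2 := congrArg (Ideal.Quotient.mk (Ideal.span {linForm F p})) hfrob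
    rw [map_pow, h0, zero_pow (pow_ne_zero _ Fintype.card_ne_zero), map_sum] at h2
    simp only [Matrix.mulVec, dotProduct, Pi.zero_apply]
    rw [h2]
    refine Finset.sum_congr rfl fun t _ => ?_
    rw [map_mul]
    rfl

/-- `L_m` divides `L_{m,k}` in `F[x_1, …, x_m]`. -/
theorem prodL_dvd_detL (m : ℕ) (k : Fin (m + 1)) :
    prodL F (fun t : Fin m => (MvPolynomial.X t : MvPolynomial (Fin m) F)) ∣ detL F m k := by
  have h : prodL F (fun t : Fin m => (MvPolynomial.X t : MvPolynomial (Fin m) F)) =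
      ∏ p : Σ k : Fin m, (Fin k → F), linForm F p := by
    rw [Fintype.prod_sigma]
    rfl
  rw [h]
  exact Fintype.prod_dvd_of_isRelPrime (fun p p' hne => linForm_isRelPrime F p p' hne)
    (fun p => linForm_dvd_detL F k p)

/-- The Dickson polynomial `Q_{m,k} = L_{m,k} / L_m` in `F[x_1, …, x_m]`. -/
def dicksonQ (m : ℕ) (k : Fin (m + 1)) : MvPolynomial (Fin m) F :=
  (prodL_dvd_detL F m k).choose

/-- The defining property of `Q_{m,k}`. -/
theorem prodL_mul_dicksonQ (m : ℕ) (k : Fin (m + 1)) :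
    prodL F (fun t : Fin m => (MvPolynomial.X t : MvPolynomial (Fin m) F)) * dicksonQ F m k =
      detL F m k :=
  (prodL_dvd_detL F m k).choose_spec.symm

/-- `L_m` is nonzero, so `Q_{m,k}` is the only polynomial with the above property. -/
theorem prodL_X_ne_zero (m : ℕ) :
    prodL F (fun t : Fin m => (MvPolynomial.X t : MvPolynomial (Fin m) F)) ≠ 0 :=
  Finset.prod_ne_zero_iff.2 fun k _ => Finset.prod_ne_zero_iff.2 fun c _ =>
    (irreducible_linForm F ⟨k, c⟩).ne_zero

variable {n : ℕ} (I : Composition n)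

/-- `v_{i,j} = ∏_c (c_1 x_1 + ⋯ + c_{m_{i-1}} x_{m_{i-1}} + x_{m_{i-1}+j})`, over all
`c ∈ F^{m_{i-1}}`.  For the block `i` counted from `0`, the partial sum of the preceding
parts is `I.sizeUpTo i`, and `I.embedding i j` is the `j`-th position in block `i`. -/
def blockV (i : Fin I.length) (j : Fin (I.blocksFun i)) : MvPolynomial (Fin n) F :=
  ∏ c : Fin (I.sizeUpTo i) → F,
    (∑ t, c t • MvPolynomial.X (Fin.castLE (I.sizeUpTo_le i) t) +
      MvPolynomial.X (I.embedding i j))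

/-- `θ_i = L_{n_i}(v_{i,1}, …, v_{i,n_i})`. -/
def theta (i : Fin I.length) : MvPolynomial (Fin n) F :=
  prodL F (blockV F I i)

/-- `q_{i,k} = Q_{n_i,k}(v_{i,1}, …, v_{i,n_i})`. -/
def blockQ (i : Fin I.length) (k : Fin (I.blocksFun i)) : MvPolynomial (Fin n) F :=
  MvPolynomial.aeval (blockV F I i) (dicksonQ F (I.blocksFun i) k.castSucc)

/-- The `n` generators: for each block `i` the elements
`θ_i, q_{i,1}, …, q_{i,n_i-1}`. -/
def generator (p : Σ i : Fin I.length, Fin (I.blocksFun i)) : MvPolynomial (Fin n) F :=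
  if (p.2 : ℕ) = 0 then theta F I p.1 else blockQ F I p.1 p.2

end Dickson

/-! ### Row determinants and Mui's elements -/

section Mui

/-- The row determinant of a square matrix over a possibly noncommutative ring. -/
def rowDet {A : Type*} [Ring A] {m : ℕ} (N : Matrix (Fin m) (Fin m) A) : A :=
  ∑ σ : Equiv.Perm (Fin m), (Equiv.Perm.sign σ : ℤ) • (List.ofFn fun r => N r (σ r)).prod

/-- The integral form of `(1 / j!) * rowDet N` for a matrix `N` whose first `j` rows are equal and
have pairwise anticommuting, square-zero entries.  In the expansion of `rowDet N` the terms of `σ`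
and `σ ∘ π` agree for each permutation `π` of the first `j` rows; exactly one term of each such
class of `j!` equal terms is kept, the one for which `σ` is increasing on the first `j` rows. -/
def rowDetDivFactorial {A : Type*} [Ring A] {m : ℕ} (j : ℕ) (N : Matrix (Fin m) (Fin m) A) : A :=
  ∑ σ : Equiv.Perm (Fin m) with ∀ r s : Fin m, r < s → (s : ℕ) < j → σ r < σ s,
    (Equiv.Perm.sign σ : ℤ) • (List.ofFn fun r => N r (σ r)).prod

/-- The `m × m` matrix whose first `j` rows are `(y_1, …, y_m)`, followed by the rows
`(x_1^(q^e), …, x_m^(q^e))` for those `e ∈ {0, …, m-1}` not among the `b_t`, in increasing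
order of `e`. -/
def muiMatrix {A : Type*} [Ring A] (q : ℕ) {m j : ℕ} (b : Fin j → ℕ) (x y : Fin m → A) :
    Matrix (Fin m) (Fin m) A :=
  Matrix.of fun r c =>
    if (r : ℕ) < j then y c else x c ^ q ^ Nat.nth (fun e => e ∉ Set.range b) (r - j)

/-- The algebra `S(V) ⊗ Λ(V)` for `V = R^n`, with `S(V)` identified with `R[x_1, …, x_n]`. -/
def SymExt (R : Type*) [CommRing R] (n : ℕ) : Type _ :=
  @TensorProduct R _ (MvPolynomial (Fin n) R) (ExteriorAlgebra R (Fin n → R)) _ _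
    Algebra.toModule Algebra.toModule

variable (R : Type*) [CommRing R] {n : ℕ}

instance : Ring (SymExt R n) :=
  inferInstanceAs (Ring (MvPolynomial (Fin n) R ⊗[R] ExteriorAlgebra R (Fin n → R)))

instance : Algebra R (SymExt R n) :=
  inferInstanceAs (Algebra R (MvPolynomial (Fin n) R ⊗[R] ExteriorAlgebra R (Fin n → R)))

/-- `S(V) ⊗ Λ(V)` is an algebra over `S(V)`, through multiplication by `f ⊗ 1`. -/
instance : Algebra (MvPolynomial (Fin n) R) (SymExt R n) :=
  inferInstanceAs (Algebra (MvPolynomial (Fin n) R)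
    (MvPolynomial (Fin n) R ⊗[R] ExteriorAlgebra R (Fin n → R)))

instance : IsScalarTower R (MvPolynomial (Fin n) R) (SymExt R n) :=
  inferInstanceAs (IsScalarTower R (MvPolynomial (Fin n) R)
    (MvPolynomial (Fin n) R ⊗[R] ExteriorAlgebra R (Fin n → R)))

/-- The pure tensor `f ⊗ w` in `S(V) ⊗ Λ(V)`. -/
def SymExt.tmul (f : MvPolynomial (Fin n) R) (w : ExteriorAlgebra R (Fin n → R)) : SymExt R n :=
  (f ⊗ₜ[R] w : MvPolynomial (Fin n) R ⊗[R] ExteriorAlgebra R (Fin n → R))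

/-- The polynomial generators `x_t ⊗ 1`. -/
def symX (t : Fin n) : SymExt R n := SymExt.tmul R (MvPolynomial.X t) 1

/-- The exterior generators `1 ⊗ y_t`; `x_t` and `y_t` both come from the `t`-th standard basis
vector of `V`. -/
def extY (t : Fin n) : SymExt R n := SymExt.tmul R 1 (ExteriorAlgebra.ι R (Pi.single t 1))

/-- Mui's element `M_{m;b_1,…,b_j}` of `R[x_1, …, x_n] ⊗ E[y_1, …, y_n]`, for `m ≤ n`. -/
def mui (q : ℕ) {m j : ℕ} (hm : m ≤ n) (b : Fin j → ℕ) : SymExt R n :=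
  rowDetDivFactorial j (muiMatrix q b (fun t : Fin m => symX R (Fin.castLE hm t))
    (fun t : Fin m => extY R (Fin.castLE hm t)))

theorem prod_extY {j : ℕ} (f : Fin j → Fin n) :
    (List.ofFn fun r => extY R (f r)).prod =
      SymExt.tmul R 1 (ExteriorAlgebra.ιMulti R j fun r => Pi.single (f r) 1) := by
  rw [ExteriorAlgebra.ιMulti_apply]
  have h : ∀ l : List (ExteriorAlgebra R (Fin n → R)),
      SymExt.tmul R (n := n) 1 l.prod = (l.map (SymExt.tmul R 1)).prod := by
    intro l
    exact map_list_prod (Algebra.TensorProduct.includeRight :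
      ExteriorAlgebra R (Fin n → R) →ₐ[R]
        (MvPolynomial (Fin n) R ⊗[R] ExteriorAlgebra R (Fin n → R))) l
  rw [h, List.map_ofFn]
  rfl

theorem mui_term_perm (q : ℕ) {j k : ℕ} (b : Fin j → ℕ) (x : Fin (j + k) → SymExt R n)
    (f : Fin (j + k) → Fin n) (σ : Equiv.Perm (Fin (j + k))) (π : Equiv.Perm (Fin j)) :
    (Equiv.Perm.sign (σ * π.extendDomain (Fin.castLEquiv (Nat.le_add_right j k))) : ℤ) •
      (List.ofFn fun r => muiMatrix q b x (fun t => extY R (f t)) r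
        ((σ * π.extendDomain (Fin.castLEquiv (Nat.le_add_right j k))) r)).prod =
    (Equiv.Perm.sign σ : ℤ) •
      (List.ofFn fun r => muiMatrix q b x (fun t => extY R (f t)) r (σ r)).prod := by
  have h1 : ∀ r : Fin j, π.extendDomain (Fin.castLEquiv (Nat.le_add_right j k))
      (Fin.castLE (Nat.le_add_right j k) r) = Fin.castLE (Nat.le_add_right j k) (π r) := fun r =>
    Equiv.Perm.extendDomain_apply_image π (Fin.castLEquiv (Nat.le_add_right j k)) r
  have h2 : ∀ r : Fin k, π.extendDomain (Fin.castLEquiv (Nat.le_add_right j k))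
      (Fin.natAdd j r) = Fin.natAdd j r := fun r =>
    Equiv.Perm.extendDomain_apply_not_subtype _ _ (by simp)
  have h3 : ∀ (r : Fin j) c, muiMatrix q b x (fun t => extY R (f t))
      (Fin.castLE (Nat.le_add_right j k) r) c = extY R (f c) := fun r c => by
    simp [muiMatrix]
  have h4 : ∀ (a c : SymExt R n), ((Equiv.Perm.sign π : ℤ) • a) * c =
      (Equiv.Perm.sign π : ℤ) • (a * c) := fun a c => smul_mul_assoc _ _ _
  have h5 : (SymExt.tmul R 1 (ExteriorAlgebra.ιMulti R j fun r =>
      Pi.single (f (σ (Fin.castLE (Nat.le_add_right j k) (π r)))) 1) : SymExt R n) =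
      (Equiv.Perm.sign π : ℤ) • SymExt.tmul R 1 (ExteriorAlgebra.ιMulti R j fun r =>
      Pi.single (f (σ (Fin.castLE (Nat.le_add_right j k) r))) 1) := by
    have := AlternatingMap.map_perm (ExteriorAlgebra.ιMulti R (M := Fin n → R) j)
      (fun r => Pi.single (f (σ (Fin.castLE (Nat.le_add_right j k) r))) 1) π
    rw [Units.smul_def] at this
    have h6 := congrArg (SymExt.tmul R (n := n) 1) this
    refine h6.trans ?_
    exact map_zsmul (Algebra.TensorProduct.includeRight :
      ExteriorAlgebra R (Fin n → R) →ₐ[R]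
        (MvPolynomial (Fin n) R ⊗[R] ExteriorAlgebra R (Fin n → R))) _ _
  rw [List.ofFn_add, List.ofFn_add, List.prod_append, List.prod_append]
  simp only [Equiv.Perm.mul_apply, h1, h2, h3, prod_extY]
  rw [h5, h4, smul_smul, map_mul, Equiv.Perm.sign_extendDomain]
  congr 1
  rcases Int.units_eq_one_or (Equiv.Perm.sign π) with h | h <;> simp [h]

/-- Over every coefficient ring, `j! * M_{m;b_1,…,b_j}` is the row determinant of the matrix with
`j` repeated rows `y`. -/
theorem rowDet_muiMatrix (q : ℕ) {m j : ℕ} (hm : m ≤ n) (hj : j ≤ m) (b : Fin j → ℕ) :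
    rowDet (muiMatrix q b (fun t : Fin m => symX R (Fin.castLE hm t))
      (fun t : Fin m => extY R (Fin.castLE hm t))) = j.factorial • mui R q hm b := by
  obtain ⟨k, rfl⟩ := Nat.exists_eq_add_of_le hj
  have key := fun σ π => mui_term_perm R q b (fun t : Fin (j + k) => symX R (Fin.castLE hm t))
    (fun t => Fin.castLE hm t) σ π
  unfold rowDet mui rowDetDivFactorial
  set T : Equiv.Perm (Fin (j + k)) → SymExt R n := fun σ => (Equiv.Perm.sign σ : ℤ) •
    (List.ofFn fun r => muiMatrix q b (fun t : Fin (j + k) => symX R (Fin.castLE hm t))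
      (fun t : Fin (j + k) => extY R (Fin.castLE hm t)) r (σ r)).prod with hT
  set E : Equiv.Perm (Fin j) → Equiv.Perm (Fin (j + k)) := fun π =>
    π.extendDomain (Fin.castLEquiv (Nat.le_add_right j k)) with hE
  have hE1 : ∀ π (r : Fin j), E π (Fin.castLE (Nat.le_add_right j k) r) =
      Fin.castLE (Nat.le_add_right j k) (π r) := fun π r =>
    Equiv.Perm.extendDomain_apply_image π (Fin.castLEquiv (Nat.le_add_right j k)) r
  have hEm : ∀ π π', E (π * π') = E π * E π' := fun π π' =>
    (Equiv.Perm.extendDomain_mul _ _ _).symm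
  have hE0 : E 1 = 1 := Equiv.Perm.extendDomain_one _
  replace key : ∀ σ π, T (σ * E π) = T σ := key
  have hmono : ∀ σ : Equiv.Perm (Fin (j + k)),
      (∀ r s : Fin (j + k), r < s → (s : ℕ) < j → σ r < σ s) ↔
      StrictMono fun r : Fin j => σ (Fin.castLE (Nat.le_add_right j k) r) := by
    intro σ
    constructor
    · intro h r s hrs
      exact h _ _ hrs s.2
    · intro h r s hrs hs
      have hr : (r : ℕ) < j := lt_trans hrs hs
      exact h (a := ⟨r, hr⟩) (b := ⟨s, hs⟩) hrs
  change ∑ σ, T σ = j.factorial • ∑ σ with _, T σ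
  have hcard : j.factorial = (Finset.univ : Finset (Equiv.Perm (Fin j))).card := by
    rw [Finset.card_univ, Fintype.card_perm, Fintype.card_fin]
  rw [Finset.smul_sum]
  have hsum : ∀ σ, j.factorial • T σ = ∑ π, T (σ * E π) := by
    intro σ
    simp only [key, Finset.sum_const, hcard]
  simp only [hsum]
  rw [← Finset.sum_product']
  let S : Equiv.Perm (Fin (j + k)) → Equiv.Perm (Fin j) := fun σ =>
    Tuple.sort fun r : Fin j => σ (Fin.castLE (Nat.le_add_right j k) r)
  have hinj : ∀ σ : Equiv.Perm (Fin (j + k)), Function.Injective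
      fun r : Fin j => σ (Fin.castLE (Nat.le_add_right j k) r) := fun σ =>
    σ.injective.comp (Fin.castLE_injective _)
  refine (Finset.sum_bij' (fun p _ => p.1 * E p.2) (fun σ _ => (σ * E (S σ), (S σ)⁻¹))
    ?_ ?_ ?_ ?_ ?_).symm
  · intro p _; exact Finset.mem_univ _
  · intro σ _
    refine Finset.mem_product.2 ⟨Finset.mem_filter.2 ⟨Finset.mem_univ _, ?_⟩, Finset.mem_univ _⟩
    rw [hmono]
    simp only [Equiv.Perm.mul_apply, hE1]
    exact (Tuple.monotone_sort
      fun r : Fin j => σ (Fin.castLE (Nat.le_add_right j k) r)).strictMono_of_injective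
      ((hinj σ).comp (S σ).injective)
  · rintro ⟨σ, π⟩ hp
    have hσ : StrictMono fun r : Fin j => σ (Fin.castLE (Nat.le_add_right j k) r) :=
      (hmono σ).1 (Finset.mem_filter.1 (Finset.mem_product.1 hp).1).2
    have hS : S (σ * E π) = π⁻¹ := by
      apply Equiv.ext
      intro r
      apply hinj (σ * E π)
      have := Tuple.unique_monotone
        (f := fun r : Fin j => (σ * E π) (Fin.castLE (Nat.le_add_right j k) r))
        (Tuple.monotone_sort _) (τ := π⁻¹) (by
          have : (fun r : Fin j => (σ * E π) (Fin.castLE (Nat.le_add_right j k) r)) ∘ ⇑(π⁻¹) =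
              fun r : Fin j => σ (Fin.castLE (Nat.le_add_right j k) r) := by
            funext r
            simp [hE1]
          rw [this]
          exact hσ.monotone)
      exact congrFun this r
    simp only [hS, mul_assoc, ← hEm, mul_inv_cancel, hE0, mul_one, inv_inv]
  · intro σ _
    simp only [mul_assoc, ← hEm, mul_inv_cancel, hE0, mul_one]
  · intro p _
    rfl

end Mui

/-! ### The group and its actions -/

section Group

variable {F : Type*} [Field F] {n : ℕ}

theorem block_mul (I : Composition n) (M N : Matrix (Fin n) (Fin n) F)
    (hM : M.BlockTriangular I.index) (hN : N.BlockTriangular I.index) (i : Fin I.length) :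
    (M * N).submatrix (I.embedding i) (I.embedding i) =
      M.submatrix (I.embedding i) (I.embedding i) *
        N.submatrix (I.embedding i) (I.embedding i) := by
  ext a b
  simp only [Matrix.submatrix_apply, Matrix.mul_apply]
  rw [← Finset.sum_subset (Finset.subset_univ
    (Finset.univ.map (I.embedding i).toEmbedding)), Finset.sum_map]
  · rfl
  · intro t _ ht
    have hne : I.index t ≠ i := by
      rintro rfl
      exact ht (Finset.mem_map.2 ⟨I.invEmbedding t, Finset.mem_univ _, I.embedding_comp_inv t⟩)
    rcases lt_or_gt_of_ne hne with h | h
    · rw [hM (by rwa [I.index_embedding]), zero_mul]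
    · rw [hN (by rwa [I.index_embedding]), mul_zero]

/-- The group `K_I`: invertible matrices that are block upper triangular for the composition `I`
and whose diagonal blocks have determinant `1`. -/
def groupK (F : Type*) [Field F] (I : Composition n) : Subgroup (GL (Fin n) F) where
  carrier := {g | (g : Matrix (Fin n) (Fin n) F).BlockTriangular I.index ∧
    ∀ i, ((g : Matrix (Fin n) (Fin n) F).submatrix (I.embedding i) (I.embedding i)).det = 1}
  one_mem' := by
    refine ⟨Matrix.blockTriangular_one, fun i => ?_⟩
    rw [Units.val_one, Matrix.submatrix_one _ (I.embedding i).injective, Matrix.det_one]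
  mul_mem' := by
    rintro g h ⟨hg, hg'⟩ ⟨hh, hh'⟩
    refine ⟨hg.mul hh, fun i => ?_⟩
    rw [Units.val_mul, block_mul I _ _ hg hh, Matrix.det_mul, hg', hh', one_mul]
  inv_mem' := by
    rintro g ⟨hg, hg'⟩
    have hinv : ((g⁻¹ : GL (Fin n) F) : Matrix (Fin n) (Fin n) F).BlockTriangular I.index := by
      rw [Matrix.coe_units_inv]
      have : Invertible (g : Matrix (Fin n) (Fin n) F) := g.invertible
      exact Matrix.blockTriangular_inv_of_blockTriangular hg
    refine ⟨hinv, fun i => ?_⟩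
    have h1 := block_mul I _ _ hg hinv i
    rw [← Units.val_mul, mul_inv_cancel, Units.val_one,
      Matrix.submatrix_one _ (I.embedding i).injective] at h1
    have h2 := congrArg Matrix.det h1
    rw [Matrix.det_one, Matrix.det_mul, hg', one_mul] at h2
    exact h2.symm

/-- The action of `g` on `S(V)`: the algebra map with `g · x_j = ∑_k g_{kj} x_k`. -/
def symAct (g : GL (Fin n) F) : MvPolynomial (Fin n) F →ₐ[F] MvPolynomial (Fin n) F :=
  MvPolynomial.aeval fun j => ∑ k, (g : Matrix (Fin n) (Fin n) F) k j • MvPolynomial.X k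

/-- The action of `g` on `Λ(V)` induced by the standard action on `V = F^n`. -/
def extAct (g : GL (Fin n) F) :
    ExteriorAlgebra F (Fin n → F) →ₐ[F] ExteriorAlgebra F (Fin n → F) :=
  ExteriorAlgebra.map (Matrix.toLin' (g : Matrix (Fin n) (Fin n) F))

/-- The diagonal action of `g` on `S(V) ⊗ Λ(V)`. -/
def symExtAct (g : GL (Fin n) F) : SymExt F n →ₐ[F] SymExt F n :=
  (Algebra.TensorProduct.map (symAct g) (extAct g) :
    MvPolynomial (Fin n) F ⊗[F] ExteriorAlgebra F (Fin n → F) →ₐ[F]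
      MvPolynomial (Fin n) F ⊗[F] ExteriorAlgebra F (Fin n → F))

/-- The algebra of invariants `S(V)^G`. -/
def symInv (G : Subgroup (GL (Fin n) F)) : Subalgebra F (MvPolynomial (Fin n) F) where
  carrier := {f | ∀ g ∈ G, symAct g f = f}
  mul_mem' := fun ha hb g hg => by rw [map_mul, ha g hg, hb g hg]
  add_mem' := fun ha hb g hg => by rw [map_add, ha g hg, hb g hg]
  algebraMap_mem' := fun r g _ => AlgHom.commutes _ r

theorem symExtAct_smul (g : GL (Fin n) F) (f : MvPolynomial (Fin n) F) (w : SymExt F n) :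
    symExtAct g (f • w) = symAct g f • symExtAct g w := by
  have h : ∀ (f : MvPolynomial (Fin n) F), algebraMap _ (SymExt F n) f = SymExt.tmul F f 1 :=
    fun _ => rfl
  have h' : symExtAct g (SymExt.tmul F f 1) = SymExt.tmul F (symAct g f) (extAct g 1) := rfl
  rw [Algebra.smul_def, Algebra.smul_def, map_mul, h, h, h', map_one]

/-- The invariants `(S(V) ⊗ Λ(V))^G`, as a module over `S(V)^G`, where `f ∈ S(V)^G` acts as
multiplication by `f ⊗ 1`. -/
def symExtInv (G : Subgroup (GL (Fin n) F)) : Submodule (symInv G) (SymExt F n) where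
  carrier := {w | ∀ g ∈ G, symExtAct g w = w}
  add_mem' := fun ha hb g hg => by rw [map_add, ha g hg, hb g hg]
  zero_mem' := fun g _ => map_zero _
  smul_mem' := fun f w hw g hg => by
    rw [Subalgebra.smul_def, symExtAct_smul, hw g hg, f.2 g hg]

instance symExtInvModule (G : Subgroup (GL (Fin n) F)) : Module (symInv G) (symExtInv G) :=
  (symExtInv G).module

instance symExtInvSMul (G : Subgroup (GL (Fin n) F)) : SMul (symInv G) (symExtInv G) :=
  (symExtInvModule G).toSMul

end Group

/-- The indices `(i; b_1, …, b_j)` with `1 ≤ j ≤ m_i`, `0 ≤ b_1 < ⋯ < b_j ≤ m_i - 1` and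
`b_j ≥ m_{i-1}`.  With the block `i` counted from `0`, `m_i` is `I.sizeUpTo (i + 1)` and
`m_{i-1}` is `I.sizeUpTo i`. -/
structure MuiIndex {n : ℕ} (I : Composition n) where
  i : Fin I.length
  j : ℕ
  one_le : 1 ≤ j
  le_size : j ≤ I.sizeUpTo (i + 1)
  b : Fin j → ℕ
  strictMono : StrictMono b
  lt_size : ∀ t, b t < I.sizeUpTo (i + 1)
  size_le : I.sizeUpTo i ≤ b ⟨j - 1, Nat.sub_lt one_le Nat.one_pos⟩

/-- The element `M_{m_i;b_1,…,b_j}` for `q = |F|`. -/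
def muiElement (F : Type*) [Field F] [Fintype F] {n : ℕ} {I : Composition n} (d : MuiIndex I) :
    SymExt F n :=
  mui F (Fintype.card F) (I.sizeUpTo_le (d.i + 1)) d.b

end

end DicksonMui

/-!
The two parts rest on different arguments; both use Moore's formula `det_moore`, which writes the
product `L_m` as the determinant of the matrix `(u_c^(q^r))`.

*The invariant ring.* Expanding the Moore determinant of `u_1, …, u_m, z` along its last column gives
the fundamental equation `linProd_eq_sum`: the product of all `∑ c_t u_t + z` is a `q`-polynomial in
`z` whose coefficients are Dickson polynomials in the `u`'s. Composing these equations block by block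
shows that, for every `i`, the monic polynomial whose roots are the linear forms in
`x_1, …, x_{m_i}` has its coefficients in the algebra `A` generated by the `θ_i` and `q_{i,k}`
(`vanPoly_mem_lifts`). In particular the variables are integral over `A`, so the `n` generators are
algebraically independent by transcendence degree, and `A`, a polynomial ring, is integrally closed.
The field `F(x_1, …, x_n)` is the splitting field over `Frac A` of the last of these separable
polynomials. An automorphism of it over `Frac A` permutes the roots of each of these polynomials, so
it is a linear substitution preserving the flag of the blocks; it fixes each `θ_i`, which it
multiplies by the determinant of the `i`-th diagonal block, so it comes from `K_I`
(`exists_groupK_of_fixes`). By Galois theory an invariant lies in `Frac A`, and then in `A` by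
integrality.

*The invariant forms.* A form of exterior degree `j` is evaluated on `j` of the Frobenius vectors
`(x_1^(q^e), …, x_n^(q^e))`. These are invariant under `GL_n(q)`, so the values of an invariant form
are invariant polynomials, and those with `e < n` are a basis over the field of fractions, so the
values determine the form (`eq_zero_of_frobVal_eq_zero`). By Laplace expansion (`evalAt_mui`) the
value of `M_{m;b}` at exponents `a` below `m` is `± L_m` if `a = b` and is `0` otherwise. Hence the
matrix of values of the proposed basis is triangular with respect to the blocks, with nonzero diagonal
entries, and the proposed basis is linearly independent.

For generation, the blocks are treated in turn. Suppose that all values of an invariant form at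
exponents below `m_{i-1}` vanish. The point is that all its values are then divisible by `L_{m_i}`
(`prodL_lowX_dvd_frobVal`). Let `k ≤ m_i`. Modulo `x_k`, the transvections `x_c ↦ x_c + x_k` with `c`
in the block of `k` or later act trivially on polynomials, and invariance under them shows that the
form depends only on the components of the vectors in the blocks before that of `k`
(`altForm_killVar_update`); the vanishing values then make it zero modulo `x_k` (`X_dvd_frobVal`). As
unipotent elements of `K_I` carry `x_k` to every linear form with leading term `x_k`, the product
`L_{m_i}` of these coprime forms divides the values. The quotients by `± L_{m_i}` are invariant, and
subtracting the corresponding multiples of the elements `M_{m_i;b}` makes all values at exponents below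
`m_i` vanish (`exists_mem_span_frobVal_sub`).
-/

open scoped TensorProduct Matrix

namespace DicksonMui

noncomputable section

/-! ### Moore determinants and products of linear forms -/

section Moore

set_option linter.unusedSectionVars false

variable {F : Type*} [Field F] [Fintype F]

theorem sum_smul_pow_card {ι A : Type*} [Fintype ι] [CommRing A] [Algebra F A] (c : ι → F)
    (u : ι → A) (e : ℕ) :
    (∑ t, c t • u t) ^ Fintype.card F ^ e = ∑ t, c t • u t ^ Fintype.card F ^ e := by
  have hpow : ∀ a : A, ((FiniteField.frobeniusAlgHom F A) ^ e) a = a ^ Fintype.card F ^ e := by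
    intro a
    rw [AlgHom.coe_pow, FiniteField.coe_frobeniusAlgHom, pow_iterate]
  simp only [← hpow, map_sum, map_smul]

variable (F)

/-- The product `∏_c (∑ c_t u_t + z)` over all families of scalars `c`: the polynomial whose
roots in `z` are the elements of the span of `u`. -/
def linProd {ι A : Type*} [Fintype ι] [DecidableEq ι] [CommRing A] [Algebra F A] (u : ι → A)
    (z : A) : A :=
  ∏ c : ι → F, (∑ t, c t • u t + z)

/-- The Moore matrix `(u_c^(q^r))`. -/
def moore {A : Type*} [CommRing A] {m : ℕ} (u : Fin m → A) : Matrix (Fin m) (Fin m) A :=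
  Matrix.of fun r c => u c ^ Fintype.card F ^ (r : ℕ)

/-- The determinant `L_{m,k}` evaluated at a family `u`. -/
def detRows {A : Type*} [CommRing A] {m : ℕ} (u : Fin m → A) (k : Fin (m + 1)) : A :=
  (Matrix.of fun r c : Fin m => u c ^ Fintype.card F ^ (k.succAbove r : ℕ)).det

variable {F}

section Maps

variable {A B : Type*} [CommRing A] [CommRing B] [Algebra F A] [Algebra F B]

theorem map_linProd {ι : Type*} [Fintype ι] [DecidableEq ι] (f : A →ₐ[F] B) (u : ι → A) (z : A) :
    f (linProd F u z) = linProd F (fun t => f (u t)) (f z) := by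
  simp [linProd, map_prod]

theorem map_prodV (f : A →ₐ[F] B) {m : ℕ} (u : Fin m → A) (k : Fin m) :
    f (prodV F u k) = prodV F (fun t => f (u t)) k := by
  simp [prodV, map_prod]

theorem map_prodL (f : A →ₐ[F] B) {m : ℕ} (u : Fin m → A) :
    f (prodL F u) = prodL F (fun t => f (u t)) := by
  simp [prodL, map_prod, map_prodV]

theorem map_det_moore (f : A →+* B) {m : ℕ} (u : Fin m → A) :
    f (moore F u).det = (moore F fun t => f (u t)).det := by
  rw [RingHom.map_det]
  congr 1
  ext r c
  simp [moore]

theorem aeval_detL {m : ℕ} (u : Fin m → A) (k : Fin (m + 1)) :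
    MvPolynomial.aeval u (detL F m k) = detRows F u k := by
  rw [detL, AlgHom.map_det, detRows]
  congr 1
  ext r c
  simp

theorem aeval_prodL {m : ℕ} (u : Fin m → A) :
    MvPolynomial.aeval u (prodL F (MvPolynomial.X : Fin m → MvPolynomial (Fin m) F)) =
      prodL F u := by
  rw [map_prodL]
  simp

theorem prodL_mul_aeval_dicksonQ {m : ℕ} (u : Fin m → A) (k : Fin (m + 1)) :
    prodL F u * MvPolynomial.aeval u (dicksonQ F m k) = detRows F u k := by
  rw [← aeval_prodL, ← map_mul, ← aeval_detL]
  exact congrArg _ (prodL_mul_dicksonQ F m k)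

end Maps

theorem detRows_last {A : Type*} [CommRing A] {m : ℕ} (u : Fin m → A) :
    detRows F u (Fin.last m) = (moore F u).det := by
  simp [detRows, moore]

theorem detRows_zero {A : Type*} [CommRing A] [Algebra F A] {m : ℕ} (u : Fin m → A) :
    detRows F u 0 = (moore F u).det ^ Fintype.card F := by
  have h := map_det_moore (F := F) (FiniteField.frobeniusAlgHom F A).toRingHom u
  have h' : (FiniteField.frobeniusAlgHom F A).toRingHom (moore F u).det =
    (moore F u).det ^ Fintype.card F := rfl
  rw [← h', h]
  refine congrArg Matrix.det ?_
  ext r c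
  simp [moore, ← pow_mul, pow_succ']

/-- Expansion of the Moore determinant along its last column. -/
theorem det_moore_snoc {A : Type*} [CommRing A] {m : ℕ} (u : Fin m → A) (z : A) :
    (moore F (Fin.snoc u z : Fin (m + 1) → A)).det =
      ∑ k : Fin (m + 1), (-1) ^ ((k : ℕ) + m) * z ^ Fintype.card F ^ (k : ℕ) *
        detRows F u k := by
  rw [Matrix.det_succ_column _ (Fin.last m)]
  refine Finset.sum_congr rfl fun k _ => ?_
  have : (moore F (Fin.snoc u z : Fin (m + 1) → A)).submatrix k.succAbove (Fin.last m).succAbove =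
      Matrix.of fun r c : Fin m => u c ^ Fintype.card F ^ (k.succAbove r : ℕ) := by
    ext r c
    simp [moore]
  rw [this]
  simp [moore, detRows]

/-- A linear relation over `F` between the `u`'s is preserved by the Frobenius map, so it is a relation
between the columns of the Moore matrix. -/
theorem det_moore_eq_zero {A : Type*} [CommRing A] [IsDomain A] [Algebra F A] {m : ℕ}
    (u : Fin m → A) (c : Fin m → F) (hc : c ≠ 0) (h : ∑ t, c t • u t = 0) :
    (moore F u).det = 0 := by
  apply Matrix.exists_mulVec_eq_zero_iff.1
  refine ⟨fun t => algebraMap F A (c t), fun h0 => hc ?_, ?_⟩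
  · funext t
    have := congrFun h0 t
    simpa using this
  · funext r
    have h2 := sum_smul_pow_card c u (r : ℕ)
    rw [h, zero_pow (pow_ne_zero _ Fintype.card_ne_zero)] at h2
    simp only [Matrix.mulVec, dotProduct, moore, Matrix.of_apply, Pi.zero_apply]
    rw [h2]
    refine Finset.sum_congr rfl fun t _ => ?_
    rw [Algebra.smul_def, mul_comm]

section Polynomial

open Polynomial

theorem linProd_X_monic {A ι : Type*} [CommRing A] [Algebra F A] [Fintype ι] [DecidableEq ι]
    (u : ι → A) :
    (linProd F (fun t => (C (u t) : A[X])) X).Monic := by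
  refine monic_prod_of_monic _ _ fun c _ => ?_
  have : ∑ t, c t • (C (u t) : A[X]) + X = X + C (∑ t, c t • u t) := by
    simp [add_comm, map_sum, Polynomial.smul_C]
  rw [this]
  exact monic_X_add_C _

theorem linProd_X_eq {A ι : Type*} [CommRing A] [Algebra F A] [Fintype ι] [DecidableEq ι]
    (u : ι → A) :
    linProd F (fun t => (C (u t) : A[X])) X = ∏ c : ι → F, (X - C (∑ t, c t • u t)) := by
  refine Fintype.prod_equiv (Equiv.neg _) _ _ fun c => ?_
  simp [add_comm, map_sum, Polynomial.smul_C]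

theorem natDegree_linProd_X {A ι : Type*} [CommRing A] [Nontrivial A] [Algebra F A] [Fintype ι]
    [DecidableEq ι] (u : ι → A) :
    (linProd F (fun t => (C (u t) : A[X])) X).natDegree =
      Fintype.card F ^ Fintype.card ι := by
  rw [linProd_X_eq, natDegree_prod_of_monic _ _ fun c _ => monic_X_sub_C _]
  simp only [natDegree_X_sub_C]
  simp

/-- Both sides are polynomials in the last variable with the same leading coefficient and the same
`q^m` roots, the linear combinations of the other variables. -/
theorem det_moore_snoc_X {A : Type*} [CommRing A] [IsDomain A] [Algebra F A] {m : ℕ} (u : Fin m → A)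
    (hinj : Function.Injective fun c : Fin m → F => (∑ t, c t • u t)) :
    (moore F (Fin.snoc (fun t : Fin m => C (u t)) X : Fin (m + 1) → A[X])).det =
    C (moore F u).det * linProd F (fun t => C (u t)) X := by
  classical
  set D := (moore F u).det with hD
  set P : A[X] := linProd F (fun t => C (u t)) X with hP
  have hq : 1 < Fintype.card F := Fintype.one_lt_card
  have hmon : P.Monic := linProd_X_monic (F := F) u
  have hcard : (Finset.univ : Finset (Fin m → F)).card = Fintype.card F ^ m := by simp
  have hN : P.natDegree = Fintype.card F ^ m := by
    have := natDegree_linProd_X (F := F) u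
    rwa [Fintype.card_fin] at this
  have h1 : (P - X ^ (Fintype.card F ^ m)).degree < ((Fintype.card F ^ m : ℕ) : WithBot ℕ) := by
    have := degree_sub_lt_left (p := P) (q := X ^ (Fintype.card F ^ m))
      (by rw [degree_eq_natDegree hmon.ne_zero, hN, degree_X_pow]) hmon.ne_zero
      (by rw [hmon.leadingCoeff, (monic_X_pow _).leadingCoeff])
    rwa [degree_eq_natDegree hmon.ne_zero, hN] at this
  have h2 : (moore F (Fin.snoc (fun t : Fin m => C (u t)) X :
      Fin (m + 1) → A[X])).det = C D * X ^ (Fintype.card F ^ m) +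
      ∑ k : Fin m, C ((-1) ^ ((k : ℕ) + m) * detRows F u k.castSucc) *
        X ^ Fintype.card F ^ (k : ℕ) := by
    rw [det_moore_snoc, Fin.sum_univ_castSucc, add_comm]
    have hC : ∀ k, detRows F (fun t : Fin m => (C (u t) : A[X])) k = C (detRows F u k) := by
      intro k
      rw [detRows, detRows, RingHom.map_det]
      congr 1
      ext r c : 2
      simp
    simp only [hC, detRows_last]
    congr 1
    · rw [Fin.val_last, ← two_mul, pow_mul, neg_one_sq, one_pow, one_mul, mul_comm]
    · refine Finset.sum_congr rfl fun k _ => ?_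
      rw [C_mul, C_pow, C_neg, C_1, Fin.val_castSucc]
      ring
  refine Polynomial.eq_of_degree_sub_lt_of_eval_index_eq
    (v := fun c : Fin m → F => - ∑ t, c t • u t) Finset.univ
    (fun c _ c' _ h => hinj (neg_injective h)) ?_ ?_
  · rw [h2, hcard]
    have h3 : ∀ s : A[X], C D * X ^ (Fintype.card F ^ m) + s - C D * P =
        s - C D * (P - X ^ (Fintype.card F ^ m)) := fun s => by ring
    rw [h3]
    refine lt_of_le_of_lt (degree_sub_le _ _) (max_lt ?_ ?_)
    · rw [degree_lt_iff_coeff_zero]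
      intro N hN
      rw [finsetSum_coeff]
      refine Finset.sum_eq_zero fun k _ => ?_
      rw [coeff_C_mul_X_pow, if_neg]
      have : Fintype.card F ^ (k : ℕ) < Fintype.card F ^ m := Nat.pow_lt_pow_right hq k.2
      omega
    · rw [degree_lt_iff_coeff_zero] at h1 ⊢
      intro N hN
      rw [coeff_C_mul, h1 N hN, mul_zero]
  · intro c _
    rw [← coe_evalRingHom, map_det_moore, coe_evalRingHom, eval_mul]
    have h0 : P.eval (-∑ t, c t • u t) = 0 := by
      rw [hP, linProd, eval_prod]
      refine Finset.prod_eq_zero (Finset.mem_univ c) ?_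
      simp [eval_finsetSum, Polynomial.smul_C]
    rw [h0, mul_zero]
    refine det_moore_eq_zero _ (Fin.snoc c 1) ?_ ?_
    · intro h
      have := congrFun h (Fin.last m)
      simp at this
    · rw [Fin.sum_univ_castSucc]
      simp

theorem sum_smul_X_injective (ι : Type*) [Fintype ι] : Function.Injective
    fun c : ι → F => (∑ t, c t • (MvPolynomial.X t : MvPolynomial ι F)) := by
  classical
  intro c c' h
  funext t
  have := congrArg (MvPolynomial.coeff (Finsupp.single t 1)) h
  simpa [MvPolynomial.coeff_sum, MvPolynomial.coeff_X, Finsupp.single_left_inj] using this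

/-- Evaluation of a polynomial over `F[x_1, …, x_m]` at a family `u` and an element `z`. -/
def evalPair {B : Type*} [CommRing B] [Algebra F B] {m : ℕ} (u : Fin m → B) (z : B) :
    (MvPolynomial (Fin m) F)[X] →ₐ[F] B :=
  { Polynomial.eval₂RingHom (MvPolynomial.aeval u : MvPolynomial (Fin m) F →ₐ[F] B).toRingHom z with
    commutes' := fun r => by
      change Polynomial.eval₂ _ z (Polynomial.C (MvPolynomial.C r)) = _
      simp }

theorem evalPair_C {B : Type*} [CommRing B] [Algebra F B] {m : ℕ} (u : Fin m → B) (z : B)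
    (p : MvPolynomial (Fin m) F) : evalPair u z (C p) = MvPolynomial.aeval u p := by
  change Polynomial.eval₂ _ z (Polynomial.C p) = _
  simp

theorem evalPair_X {B : Type*} [CommRing B] [Algebra F B] {m : ℕ} (u : Fin m → B) (z : B) :
    evalPair (F := F) u z X = z := by
  change Polynomial.eval₂ _ z X = _
  simp

theorem det_moore_snoc_eq {B : Type*} [CommRing B] [Algebra F B] {m : ℕ} (u : Fin m → B) (z : B) :
    (moore F (Fin.snoc u z : Fin (m + 1) → B)).det = (moore F u).det * linProd F u z := by
  have h := congrArg (evalPair u z) (det_moore_snoc_X (F := F)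
    (MvPolynomial.X : Fin m → MvPolynomial (Fin m) F) (sum_smul_X_injective _))
  rw [map_mul, map_linProd, evalPair_C, ← AlgHom.coe_toRingHom, map_det_moore,
    ← AlgHom.coe_toRingHom, map_det_moore] at h
  simp only [AlgHom.coe_toRingHom, evalPair_C, evalPair_X, MvPolynomial.aeval_X] at h
  rw [← h]
  congr 2
  funext t
  refine Fin.lastCases ?_ (fun t => ?_) t
  · simp [evalPair_X]
  · simp [evalPair_C]

end Polynomial

/-- Moore's determinant formula. -/
theorem det_moore {B : Type*} [CommRing B] [Algebra F B] {m : ℕ} (u : Fin m → B) :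
    (moore F u).det = prodL F u := by
  induction m with
  | zero => simp [prodL]
  | succ m ih =>
    have hu : u = Fin.snoc (Fin.init u) (u (Fin.last m)) := (Fin.snoc_init_self u).symm
    have h2 := det_moore_snoc_eq (F := F) (Fin.init u) (u (Fin.last m))
    rw [← hu, ih] at h2
    rw [h2, prodL, prodL, Fin.prod_univ_castSucc]
    rfl

section

variable {A : Type*} [CommRing A] [Algebra F A]

theorem dicksonQ_last (m : ℕ) : dicksonQ F m (Fin.last m) = 1 := by
  have h := prodL_mul_dicksonQ F m (Fin.last m)
  have h2 : detL F m (Fin.last m) = prodL F (MvPolynomial.X : Fin m → MvPolynomial (Fin m) F) := by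
    rw [← det_moore, ← detRows_last]
    rfl
  rw [h2] at h
  exact mul_left_cancel₀ (prodL_X_ne_zero F m) (by rw [h, mul_one])

theorem dicksonQ_zero (m : ℕ) : dicksonQ F m 0 =
    prodL F (MvPolynomial.X : Fin m → MvPolynomial (Fin m) F) ^ (Fintype.card F - 1) := by
  have h := prodL_mul_dicksonQ F m 0
  have h2 : detL F m 0 =
      prodL F (MvPolynomial.X : Fin m → MvPolynomial (Fin m) F) ^ Fintype.card F := by
    rw [← det_moore, ← detRows_zero]
    rfl
  rw [h2] at h
  refine mul_left_cancel₀ (prodL_X_ne_zero F m) (h.trans ?_)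
  rw [← pow_succ', Nat.sub_add_cancel Fintype.card_pos]

/-- The fundamental equation: the product of the affine forms `∑ c_t u_t + z` is a `q`-polynomial
in `z` with the Dickson polynomials as coefficients. -/
theorem linProd_eq_sum {m : ℕ} (u : Fin m → A) (z : A) :
    linProd F u z = ∑ k : Fin (m + 1), (-1) ^ ((k : ℕ) + m) *
      MvPolynomial.aeval u (dicksonQ F m k) * z ^ Fintype.card F ^ (k : ℕ) := by
  -- the generic case, in which `L_m` can be cancelled
  have gen : linProd F (fun t : Fin m => (Polynomial.C (MvPolynomial.X t) :
      Polynomial (MvPolynomial (Fin m) F))) Polynomial.X =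
      ∑ k : Fin (m + 1), (-1) ^ ((k : ℕ) + m) * MvPolynomial.aeval
        (fun t : Fin m => (Polynomial.C (MvPolynomial.X t) :
          Polynomial (MvPolynomial (Fin m) F))) (dicksonQ F m k) *
        Polynomial.X ^ Fintype.card F ^ (k : ℕ) := by
    have hne : prodL F (fun t : Fin m => (Polynomial.C (MvPolynomial.X t) :
        Polynomial (MvPolynomial (Fin m) F))) ≠ 0 := by
      have h := map_prodL (F := F) (IsScalarTower.toAlgHom F (MvPolynomial (Fin m) F)
        (Polynomial (MvPolynomial (Fin m) F))) (MvPolynomial.X : Fin m → MvPolynomial (Fin m) F)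
      intro h0
      apply prodL_X_ne_zero F m
      apply Polynomial.C_injective
      rw [map_zero, ← h0]
      exact h
    apply mul_left_cancel₀ hne
    rw [← det_moore, ← det_moore_snoc_eq, det_moore_snoc, Finset.mul_sum]
    refine Finset.sum_congr rfl fun k _ => ?_
    rw [← prodL_mul_aeval_dicksonQ, det_moore]
    ring
  have h := congrArg (evalPair u z) gen
  rw [map_linProd, map_sum] at h
  simp only [evalPair_C, evalPair_X, MvPolynomial.aeval_X, map_mul, map_pow, map_neg, map_one] at h
  rw [h]
  refine Finset.sum_congr rfl fun k _ => ?_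
  congr 2
  rw [← AlgHom.comp_apply, MvPolynomial.comp_aeval]
  simp only [evalPair_C, MvPolynomial.aeval_X]

theorem linProd_reindex {ι κ : Type*} [Fintype ι] [Fintype κ] [DecidableEq ι] [DecidableEq κ]
    (e : ι ≃ κ) (u : κ → A) (z : A) :
    linProd F (fun t => u (e t)) z = linProd F u z := by
  refine Fintype.prod_equiv (Equiv.arrowCongr e (Equiv.refl F)) _ _ fun c => ?_
  congr 1
  refine Fintype.sum_equiv e _ _ fun t => ?_
  simp

/-- Being a `q`-polynomial in the last argument, the product is linear in it over `F`. -/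
theorem linProd_sum_smul {ι κ : Type*} [Fintype ι] [DecidableEq ι] [Fintype κ] (u : ι → A)
    (c : κ → F) (w : κ → A) :
    linProd F u (∑ t, c t • w t) = ∑ t, c t • linProd F u (w t) := by
  have e := Fintype.equivFin ι
  simp only [← linProd_reindex e.symm u, linProd_eq_sum, sum_smul_pow_card, Finset.smul_sum,
    Finset.mul_sum]
  rw [Finset.sum_comm]
  refine Finset.sum_congr rfl fun t _ => Finset.sum_congr rfl fun k _ => ?_
  rw [mul_smul_comm]

theorem linProd_add {ι : Type*} [Fintype ι] [DecidableEq ι] (u : ι → A) (a b : A) :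
    linProd F u (a + b) = linProd F u a + linProd F u b := by
  simpa using linProd_sum_smul u (fun _ : Fin 2 => (1 : F)) ![a, b]

theorem linProd_span {ι : Type*} [Fintype ι] [DecidableEq ι] (u : ι → A) (c : ι → F) :
    linProd F u (∑ t, c t • u t) = 0 := by
  refine Finset.prod_eq_zero (Finset.mem_univ (-c)) ?_
  simp

/-- Vanishing polynomials of nested spans compose. -/
theorem linProd_sumElim {ι κ : Type*} [Fintype ι] [DecidableEq ι] [Fintype κ] [DecidableEq κ]
    (u : ι → A) (w : κ → A) (z : A) :
    linProd F (Sum.elim u w) z = linProd F (fun t => linProd F u (w t)) (linProd F u z) := by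
  have h : ∀ d : κ → F, ∑ t, d t • linProd F u (w t) + linProd F u z =
      ∏ c : ι → F, (∑ t, c t • u t + (∑ t, d t • w t + z)) := by
    intro d
    rw [← linProd_sum_smul, ← linProd_add]
    rfl
  rw [linProd, linProd]
  simp only [h]
  rw [← Fintype.prod_prod_type']
  refine Fintype.prod_equiv ((Equiv.sumArrowEquivProdArrow ι κ F).trans (Equiv.prodComm _ _))
    _ _ fun c => ?_
  simp [Fintype.sum_sum_type, Equiv.sumArrowEquivProdArrow, add_assoc]

/-- The linear substitution `u_j ↦ ∑_k M_{kj} u_k`. -/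
def linSubst {m : ℕ} (M : Matrix (Fin m) (Fin m) F) (u : Fin m → A) (j : Fin m) : A :=
  ∑ k, M k j • u k

theorem det_pow_linSubst {m : ℕ} (M : Matrix (Fin m) (Fin m) F) (u : Fin m → A) (e : Fin m → ℕ) :
    (Matrix.of fun r c => linSubst M u c ^ Fintype.card F ^ e r).det =
      algebraMap F A M.det * (Matrix.of fun r c => u c ^ Fintype.card F ^ e r).det := by
  rw [RingHom.map_det, mul_comm, ← Matrix.det_mul]
  congr 1
  ext r c
  simp only [Matrix.of_apply, linSubst, sum_smul_pow_card, Matrix.mul_apply]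
  refine Finset.sum_congr rfl fun t _ => ?_
  simp [Algebra.smul_def, mul_comm]

theorem detRows_linSubst {m : ℕ} (M : Matrix (Fin m) (Fin m) F) (u : Fin m → A)
    (k : Fin (m + 1)) : detRows F (linSubst M u) k = algebraMap F A M.det * detRows F u k :=
  det_pow_linSubst M u fun r => (k.succAbove r : ℕ)

theorem prodL_linSubst {m : ℕ} (M : Matrix (Fin m) (Fin m) F) (u : Fin m → A) :
    prodL F (linSubst M u) = algebraMap F A M.det * prodL F u := by
  rw [← det_moore, ← det_moore, ← detRows_last, ← detRows_last, detRows_linSubst]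

theorem aeval_linSubst_dicksonQ {m : ℕ} (M : Matrix (Fin m) (Fin m) F) (hM : M.det ≠ 0)
    (u : Fin m → A) (k : Fin (m + 1)) :
    MvPolynomial.aeval (linSubst M u) (dicksonQ F m k) = MvPolynomial.aeval u (dicksonQ F m k) := by
  have h : MvPolynomial.aeval (linSubst M (MvPolynomial.X : Fin m → MvPolynomial (Fin m) F))
      (dicksonQ F m k) = dicksonQ F m k := by
    have h1 := prodL_mul_aeval_dicksonQ (F := F) (linSubst M
      (MvPolynomial.X : Fin m → MvPolynomial (Fin m) F)) k
    have h2 := prodL_mul_aeval_dicksonQ (F := F) (MvPolynomial.X : Fin m → MvPolynomial (Fin m) F) k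
    rw [MvPolynomial.aeval_X_left_apply] at h2
    rw [detRows_linSubst, prodL_linSubst, ← h2, ← mul_assoc] at h1
    refine mul_left_cancel₀ (mul_ne_zero ?_ (prodL_X_ne_zero F m)) h1
    simpa using hM
  conv_rhs => rw [← h]
  rw [← AlgHom.comp_apply, MvPolynomial.comp_aeval]
  congr 2
  funext j
  simp [linSubst]

theorem linProd_linSubst {m : ℕ} (M : Matrix (Fin m) (Fin m) F) (hM : M.det ≠ 0)
    (u : Fin m → A) (z : A) : linProd F (linSubst M u) z = linProd F u z := by
  simp only [linProd_eq_sum, aeval_linSubst_dicksonQ M hM]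

end

end Moore

/-! ### Block triangular substitutions -/

section Blocks

theorem sum_eq_sum_castLE {M : Type*} [AddCommMonoid M] {m n : ℕ} (h : m ≤ n) (f : Fin n → M)
    (hf : ∀ k : Fin n, m ≤ k → f k = 0) : ∑ k, f k = ∑ t : Fin m, f (Fin.castLE h t) := by
  rw [← Finset.sum_subset (Finset.subset_univ
    (Finset.univ.map (Fin.castLEEmb h))), Finset.sum_map]
  · rfl
  · intro t _ ht
    refine hf t (not_lt.1 fun h' => ht ?_)
    exact Finset.mem_map.2 ⟨⟨t, h'⟩, Finset.mem_univ _, by ext; simp⟩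

variable {n : ℕ} (I : Composition n)

theorem sum_eq_sum_embedding {M : Type*} [AddCommMonoid M] (i : Fin I.length) (f : Fin n → M)
    (hf : ∀ k : Fin n, I.index k ≠ i → f k = 0) : ∑ k, f k = ∑ t, f (I.embedding i t) := by
  rw [← Finset.sum_subset (Finset.subset_univ
    (Finset.univ.map (I.embedding i).toEmbedding)), Finset.sum_map]
  · rfl
  · intro t _ ht
    refine hf t ?_
    rintro rfl
    exact ht (Finset.mem_map.2 ⟨I.invEmbedding t, Finset.mem_univ _, I.embedding_comp_inv t⟩)

theorem lt_sizeUpTo_iff (t : Fin n) (i : ℕ) : (t : ℕ) < I.sizeUpTo i ↔ (I.index t : ℕ) < i := by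
  constructor
  · intro h
    by_contra h'
    have h1 := I.sizeUpTo_index_le t
    have h2 := I.monotone_sizeUpTo (not_lt.1 h')
    omega
  · intro h
    have h1 := I.lt_sizeUpTo_index_succ t
    have h2 : I.sizeUpTo (I.index t).succ ≤ I.sizeUpTo i := I.monotone_sizeUpTo (by simpa using h)
    omega

theorem sizeUpTo_index_succ_le (t : Fin n) : (t : ℕ) < I.sizeUpTo (I.index t + 1) :=
  (lt_sizeUpTo_iff I t _).2 (Nat.lt_succ_self _)

variable {F : Type*} [Field F]

/-- The leading square submatrix of size `n_1 + ⋯ + n_i`. -/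
def leading (i : ℕ) (M : Matrix (Fin n) (Fin n) F) :
    Matrix (Fin (I.sizeUpTo i)) (Fin (I.sizeUpTo i)) F :=
  M.submatrix (Fin.castLE (I.sizeUpTo_le i)) (Fin.castLE (I.sizeUpTo_le i))

variable {I}

theorem blockTriangular_apply_eq_zero {M : Matrix (Fin n) (Fin n) F}
    (hM : M.BlockTriangular I.index) (i : ℕ) {r c : Fin n} (hr : I.sizeUpTo i ≤ r)
    (hc : (c : ℕ) < I.sizeUpTo i) : M r c = 0 := by
  apply hM
  rw [lt_sizeUpTo_iff] at hc
  have : ¬ (I.index r : ℕ) < i := fun h => absurd ((lt_sizeUpTo_iff I r i).2 h) (by omega)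
  exact Fin.lt_def.2 (by omega)

theorem leading_mul {M N : Matrix (Fin n) (Fin n) F} (hN : N.BlockTriangular I.index) (i : ℕ) :
    leading I i (M * N) = leading I i M * leading I i N := by
  ext r c
  simp only [leading, Matrix.submatrix_apply, Matrix.mul_apply]
  apply sum_eq_sum_castLE
  intro k hk
  rw [blockTriangular_apply_eq_zero hN i hk c.2, mul_zero]

theorem leading_det_ne_zero (g : GL (Fin n) F)
    (hg : (g : Matrix (Fin n) (Fin n) F).BlockTriangular I.index) (i : ℕ) :
    (leading I i (g : Matrix (Fin n) (Fin n) F)).det ≠ 0 := by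
  have h1 := leading_mul (M := ((g⁻¹ : GL (Fin n) F) : Matrix (Fin n) (Fin n) F)) hg i
  rw [← Units.val_mul, inv_mul_cancel, Units.val_one] at h1
  have h2 := congrArg Matrix.det h1
  rw [leading, Matrix.submatrix_one _ (Fin.castLE_injective _), Matrix.det_one,
    Matrix.det_mul] at h2
  exact right_ne_zero_of_mul (h2 ▸ one_ne_zero)

/-- The determinant of a leading block triangular matrix is the product of the determinants of its
diagonal blocks; only the case of blocks of determinant `1` is needed. -/
theorem det_leading_eq_one {M : Matrix (Fin n) (Fin n) F} (hM : M.BlockTriangular I.index)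
    (h1 : ∀ i, (M.submatrix (I.embedding i) (I.embedding i)).det = 1) (i : ℕ)
    (hi : i ≤ I.length) : (leading I i M).det = 1 := by
  induction i with
  | zero =>
    have : IsEmpty (Fin (I.sizeUpTo 0)) := by rw [I.sizeUpTo_zero]; infer_instance
    exact Matrix.det_isEmpty
  | succ i ih =>
    have hs : I.sizeUpTo i + I.blocksFun ⟨i, hi⟩ = I.sizeUpTo (i + 1) :=
      (I.sizeUpTo_succ' ⟨i, hi⟩).symm
    let e : Fin (I.sizeUpTo i) ⊕ Fin (I.blocksFun ⟨i, hi⟩) ≃ Fin (I.sizeUpTo (i + 1)) :=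
      finSumFinEquiv.trans (finCongr hs)
    have h2 : (leading I (i + 1) M).submatrix e e = Matrix.fromBlocks (leading I i M)
        (Matrix.of fun r c => M (Fin.castLE (I.sizeUpTo_le i) r) (I.embedding ⟨i, hi⟩ c)) 0
        (M.submatrix (I.embedding ⟨i, hi⟩) (I.embedding ⟨i, hi⟩)) := by
      ext r c
      rcases r with r | r <;> rcases c with c | c
      · rfl
      · simp only [Matrix.submatrix_apply, leading, Matrix.fromBlocks_apply₁₂, Matrix.of_apply]
        rfl
      · simp only [Matrix.submatrix_apply, leading, Matrix.fromBlocks_apply₂₁, Matrix.zero_apply]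
        exact blockTriangular_apply_eq_zero hM i (by simp [e]) (by simp [e])
      · rfl
    rw [← Matrix.det_submatrix_equiv_self e, h2, Matrix.det_fromBlocks_zero₂₁, h1,
      ih (by omega), one_mul]

end Blocks

/-! ### The action on the generators -/

section Action

set_option linter.unusedSectionVars false

variable {F : Type*} [Field F] {n : ℕ}

theorem symAct_X (g : GL (Fin n) F) (j : Fin n) :
    symAct g (MvPolynomial.X j) =
      ∑ k, (g : Matrix (Fin n) (Fin n) F) k j • (MvPolynomial.X k : MvPolynomial (Fin n) F) := by
  simp [symAct]

variable (F) in
/-- The variables `x_1, …, x_{m_i}` of the first `i` blocks. -/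
def lowX (I : Composition n) (i : ℕ) (t : Fin (I.sizeUpTo i)) : MvPolynomial (Fin n) F :=
  MvPolynomial.X (Fin.castLE (I.sizeUpTo_le i) t)

variable [Fintype F] {I : Composition n}

theorem symAct_lowX {g : GL (Fin n) F}
    (hg : (g : Matrix (Fin n) (Fin n) F).BlockTriangular I.index) (i : ℕ) :
    (fun t => symAct g (lowX F I i t)) =
      linSubst (leading I i (g : Matrix (Fin n) (Fin n) F)) (lowX F I i) := by
  funext t
  rw [lowX, symAct_X, linSubst]
  apply sum_eq_sum_castLE
  intro k hk
  rw [blockTriangular_apply_eq_zero hg i hk t.2, zero_smul]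

theorem blockV_eq (i : Fin I.length) (j : Fin (I.blocksFun i)) :
    blockV F I i j = linProd F (lowX F I i) (MvPolynomial.X (I.embedding i j)) := rfl

theorem linProd_lowX_symAct {g : GL (Fin n) F}
    (hg : (g : Matrix (Fin n) (Fin n) F).BlockTriangular I.index) (i : ℕ)
    (z : MvPolynomial (Fin n) F) :
    symAct g (linProd F (lowX F I i) z) = linProd F (lowX F I i) (symAct g z) := by
  rw [map_linProd, symAct_lowX hg, linProd_linSubst _ (leading_det_ne_zero g hg i)]

theorem sum_single_smul_lowX (i : ℕ) (t : Fin (I.sizeUpTo i)) :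
    ∑ s, (Pi.single t 1 : Fin (I.sizeUpTo i) → F) s • lowX F I i s = lowX F I i t := by
  rw [Finset.sum_eq_single t]
  · simp
  · intro s _ hs
    rw [Pi.single_eq_of_ne hs, zero_smul]
  · simp

theorem linProd_lowX_X {i : ℕ} {j : Fin n} (hj : (j : ℕ) < I.sizeUpTo i) :
    linProd F (lowX F I i) (MvPolynomial.X j) = 0 := by
  have h2 := linProd_span (F := F) (lowX F I i) (Pi.single ⟨j, hj⟩ 1)
  rwa [sum_single_smul_lowX] at h2

/-- A block triangular substitution acts on the `v_{i,j}` through its `i`-th diagonal block. -/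
theorem symAct_blockV {g : GL (Fin n) F}
    (hg : (g : Matrix (Fin n) (Fin n) F).BlockTriangular I.index) (i : Fin I.length) :
    (fun j => symAct g (blockV F I i j)) =
      linSubst ((g : Matrix (Fin n) (Fin n) F).submatrix (I.embedding i) (I.embedding i))
        (blockV F I i) := by
  funext j
  rw [blockV_eq, linProd_lowX_symAct hg, symAct_X, linProd_sum_smul, linSubst]
  refine sum_eq_sum_embedding I i _ fun k hk => ?_
  rcases lt_or_gt_of_ne hk with h | h
  · have hk' : (k : ℕ) < I.sizeUpTo i := (lt_sizeUpTo_iff I k i).2 h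
    rw [linProd_lowX_X hk', smul_zero]
  · rw [hg (by rwa [I.index_embedding]), zero_smul]

theorem symAct_theta {g : GL (Fin n) F}
    (hg : (g : Matrix (Fin n) (Fin n) F).BlockTriangular I.index) (i : Fin I.length) :
    symAct g (theta F I i) = algebraMap F _
      ((g : Matrix (Fin n) (Fin n) F).submatrix (I.embedding i) (I.embedding i)).det *
      theta F I i := by
  rw [theta, map_prodL, symAct_blockV hg, prodL_linSubst]

theorem symAct_blockQ {g : GL (Fin n) F}
    (hg : (g : Matrix (Fin n) (Fin n) F).BlockTriangular I.index) (i : Fin I.length)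
    (h0 : ((g : Matrix (Fin n) (Fin n) F).submatrix (I.embedding i) (I.embedding i)).det ≠ 0)
    (k : Fin (I.blocksFun i)) :
    symAct g (blockQ F I i k) = blockQ F I i k := by
  rw [blockQ, ← AlgHom.comp_apply, MvPolynomial.comp_aeval]
  have := symAct_blockV hg i
  rw [this, aeval_linSubst_dicksonQ _ h0]

theorem generator_mem_symInv (p : Σ i : Fin I.length, Fin (I.blocksFun i)) :
    generator F I p ∈ symInv (groupK F I) := by
  rintro g ⟨hg, hg'⟩
  rw [generator]
  split_ifs
  · rw [symAct_theta hg, hg', map_one, one_mul]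
  · exact symAct_blockQ hg _ (by rw [hg']; exact one_ne_zero) _

theorem lowX_injective (i : ℕ) :
    Function.Injective fun c : Fin (I.sizeUpTo i) → F => ∑ t, c t • lowX F I i t := by
  intro c c' h
  have hr : ∀ c : Fin (I.sizeUpTo i) → F, ∑ t, c t • lowX F I i t =
      MvPolynomial.rename (Fin.castLE (I.sizeUpTo_le i)) (∑ t, c t • MvPolynomial.X t) := by
    intro c
    simp [lowX, map_sum]
  simp only [hr] at h
  exact sum_smul_X_injective _ (MvPolynomial.rename_injective _ (Fin.castLE_injective _) h)

end Action

/-! ### Vanishing polynomials of the flag -/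

section Vanishing

open Polynomial

variable {F : Type*} [Field F] [Fintype F] {n : ℕ} (I : Composition n)

variable (F) in
/-- The algebra generated by the proposed generators. -/
abbrev genAlg : Subalgebra F (MvPolynomial (Fin n) F) :=
  Algebra.adjoin F (Set.range (generator F I))

variable (F) in
/-- The monic polynomial whose roots are the linear forms in the variables of the first `i`
blocks. -/
def vanPoly (i : ℕ) : (MvPolynomial (Fin n) F)[X] :=
  linProd F (fun t => C (lowX F I i t)) X

theorem vanPoly_monic (i : ℕ) : (vanPoly F I i).Monic := linProd_X_monic _

theorem eval₂_vanPoly {B : Type*} [CommRing B] [Algebra F B] (f : MvPolynomial (Fin n) F →ₐ[F] B)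
    (i : ℕ) (z : B) :
    (vanPoly F I i).eval₂ f.toRingHom z = linProd F (fun t => f (lowX F I i t)) z := by
  rw [vanPoly, linProd, linProd, eval₂_finsetProd]
  refine Finset.prod_congr rfl fun c _ => ?_
  simp [eval₂_finsetSum, Polynomial.smul_C]

theorem aeval_dicksonQ_mem (i : Fin I.length) (k : Fin (I.blocksFun i + 1)) :
    MvPolynomial.aeval (blockV F I i) (dicksonQ F (I.blocksFun i) k) ∈ genAlg F I := by
  refine Fin.lastCases ?_ (fun k => ?_) k
  · rw [dicksonQ_last, map_one]
    exact one_mem _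
  · by_cases hk : (k : ℕ) = 0
    · have h0 : k.castSucc = 0 := by ext; simpa using hk
      rw [h0, dicksonQ_zero, map_pow, aeval_prodL]
      apply pow_mem
      apply Algebra.subset_adjoin
      exact ⟨⟨i, k⟩, by simp [generator, hk, theta]⟩
    · apply Algebra.subset_adjoin
      exact ⟨⟨i, k⟩, by simp [generator, hk, blockQ]⟩

theorem vanPoly_succ (i : Fin I.length) :
    vanPoly F I (i + 1) = linProd F (fun j => C (blockV F I i j)) (vanPoly F I i) := by
  let e : Fin (I.sizeUpTo i) ⊕ Fin (I.blocksFun i) ≃ Fin (I.sizeUpTo (i + 1)) :=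
    finSumFinEquiv.trans (finCongr (I.sizeUpTo_succ' i).symm)
  have hC : ∀ j, (C (blockV F I i j) : (MvPolynomial (Fin n) F)[X]) =
      linProd F (fun t => C (lowX F I i t)) (C (MvPolynomial.X (I.embedding i j))) := fun j =>
    map_linProd (IsScalarTower.toAlgHom F (MvPolynomial (Fin n) F) (MvPolynomial (Fin n) F)[X]) _ _
  simp only [hC]
  rw [vanPoly, vanPoly, ← linProd_sumElim, ← linProd_reindex e]
  congr 1
  funext t
  rcases t with t | t <;> rfl

/-- By induction on the blocks: each vanishing polynomial is a `q`-polynomial in the preceding one,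
with coefficients the Dickson polynomials in the `v_{i,j}`. -/
theorem vanPoly_mem_lifts (i : ℕ) (hi : i ≤ I.length) :
    vanPoly F I i ∈ lifts (algebraMap (genAlg F I) (MvPolynomial (Fin n) F)) := by
  induction i with
  | zero =>
    have : IsEmpty (Fin (I.sizeUpTo 0)) := by rw [I.sizeUpTo_zero]; infer_instance
    have h : vanPoly F I 0 = X := by
      rw [vanPoly, linProd, Fintype.prod_unique]
      simp
    rw [h]
    exact X_mem_lifts _
  | succ i ih =>
    have ih := ih (by omega)
    rw [vanPoly_succ I ⟨i, hi⟩, linProd_eq_sum]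
    refine sum_mem fun k _ => ?_
    have hC : (MvPolynomial.aeval fun j => (C (blockV F I ⟨i, hi⟩ j) : (MvPolynomial (Fin n) F)[X]))
        (dicksonQ F (I.blocksFun ⟨i, hi⟩) k) =
        C (MvPolynomial.aeval (blockV F I ⟨i, hi⟩) (dicksonQ F (I.blocksFun ⟨i, hi⟩) k)) :=
      MvPolynomial.aeval_algebraMap_apply _ _ _
    rw [hC]
    refine mul_mem (mul_mem (pow_mem ?_ _) ?_) (pow_mem ih _)
    · have : (-1 : (MvPolynomial (Fin n) F)[X]) = C (algebraMap (genAlg F I) _ (-1)) := by simp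
      rw [this]
      exact C_mem_lifts _ _
    · exact C_mem_lifts _ (⟨_, aeval_dicksonQ_mem I ⟨i, hi⟩ k⟩ : genAlg F I)

theorem exists_lift_vanPoly (i : ℕ) (hi : i ≤ I.length) :
    ∃ p : (genAlg F I)[X], p.map (algebraMap (genAlg F I) (MvPolynomial (Fin n) F)) =
      vanPoly F I i ∧ p.Monic := by
  obtain ⟨p, h1, -, h2⟩ := lifts_and_natDegree_eq_and_monic (vanPoly_mem_lifts (F := F) I i hi)
    (vanPoly_monic I i)
  exact ⟨p, h1, h2⟩

theorem isIntegral_genAlg : Algebra.IsIntegral (genAlg F I) (MvPolynomial (Fin n) F) := by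
  have hX : ∀ j : Fin n, IsIntegral (genAlg F I) (MvPolynomial.X j : MvPolynomial (Fin n) F) := by
    intro j
    obtain ⟨p, hp, hm⟩ := exists_lift_vanPoly (F := F) I I.length le_rfl
    refine ⟨p, hm, ?_⟩
    rw [← Polynomial.eval_map, hp, Polynomial.eval]
    refine (eval₂_vanPoly I (AlgHom.id F (MvPolynomial (Fin n) F)) _ _).trans ?_
    exact linProd_lowX_X (by rw [I.sizeUpTo_length]; exact j.2)
  have htop : (integralClosure (genAlg F I) (MvPolynomial (Fin n) F)).restrictScalars F = ⊤ := by
    rw [eq_top_iff, ← MvPolynomial.adjoin_range_X]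
    refine Algebra.adjoin_le ?_
    rintro _ ⟨j, rfl⟩
    exact hX j
  refine ⟨fun p => ?_⟩
  have : p ∈ (integralClosure (genAlg F I) (MvPolynomial (Fin n) F)).restrictScalars F := by
    rw [htop]; trivial
  exact this

/-- There are as many generators as variables, and the variables are integral over them. -/
theorem algebraicIndependent_generator : AlgebraicIndependent F (generator F I) := by
  have := isIntegral_genAlg (F := F) I
  have h := Algebra.IsAlgebraic.isTranscendenceBasis_of_lift_le_trdeg_of_finite (R := F)
    (generator F I) (by
      rw [MvPolynomial.trdeg_of_isDomain, Cardinal.mk_congr I.blocksFinEquiv]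
      simp)
  exact h.1

theorem isIntegrallyClosed_genAlg : IsIntegrallyClosed (genAlg F I) :=
  IsIntegrallyClosed.of_equiv (algebraicIndependent_generator (F := F) I).aevalEquiv.toRingEquiv

end Vanishing

/-! ### The invariant ring, by Galois theory -/

section Galois

set_option linter.unusedSectionVars false

open Polynomial

variable {F : Type*} [Field F] [Fintype F] {n : ℕ} (I : Composition n)

/-- An embedding of `F[x_1, …, x_n]` that fixes the generators permutes the roots of every
vanishing polynomial of the flag, so it is a linear substitution preserving the flag. -/
theorem exists_coeff_of_fixes {E : Type*} [Field E] [Algebra F E]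
    (ι τ : MvPolynomial (Fin n) F →ₐ[F] E) (hτ : ∀ a ∈ genAlg F I, τ a = ι a) (j : Fin n) :
    ∃ c : Fin n → F, (∀ k, I.index j < I.index k → c k = 0) ∧
      τ (MvPolynomial.X j) = ι (∑ k, c k • MvPolynomial.X k) := by
  have hi : (I.index j : ℕ) + 1 ≤ I.length := (I.index j).2
  have hj : (j : ℕ) < I.sizeUpTo (I.index j + 1) := sizeUpTo_index_succ_le I j
  obtain ⟨p, hp, -⟩ := exists_lift_vanPoly (F := F) I _ hi
  have h1 : linProd F (fun t => ι (lowX F I (I.index j + 1) t)) (τ (MvPolynomial.X j)) = 0 := by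
    have h2 := map_linProd τ (lowX F I (I.index j + 1)) (MvPolynomial.X j)
    rw [linProd_lowX_X hj, map_zero] at h2
    rw [← eval₂_vanPoly, ← hp, eval₂_map] at h2 ⊢
    rw [h2]
    congr 1
    ext a
    exact (hτ a a.2).symm
  obtain ⟨c, -, hc⟩ := Finset.prod_eq_zero_iff.1 h1
  refine ⟨fun k => if h : (k : ℕ) < I.sizeUpTo (I.index j + 1) then - c ⟨k, h⟩ else 0, ?_, ?_⟩
  · intro k hk
    refine dif_neg ?_
    rw [lt_sizeUpTo_iff]
    have : (I.index j : ℕ) < I.index k := hk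
    omega
  · rw [sum_eq_sum_castLE (I.sizeUpTo_le (I.index j + 1))]
    · rw [eq_neg_of_add_eq_zero_right hc]
      simp [lowX, map_sum]
    · intro k hk
      beta_reduce
      rw [dif_neg (by omega), zero_smul]

theorem theta_ne_zero (i : Fin I.length) : theta F I i ≠ 0 := by
  have h := (algebraicIndependent_generator (F := F) I).ne_zero ⟨i, 0, I.one_le_blocksFun i⟩
  simpa [generator] using h

/-- The substitution lies in `K_I`: it is invertible because `τ` is injective, and since it multiplies
`θ_i` by the determinant of the `i`-th diagonal block, that determinant is `1`. -/
theorem exists_groupK_of_fixes {E : Type*} [Field E] [Algebra F E]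
    (ι τ : MvPolynomial (Fin n) F →ₐ[F] E) (hι : Function.Injective ι) (hinj : Function.Injective τ)
    (hτ : ∀ a ∈ genAlg F I, τ a = ι a) :
    ∃ g ∈ groupK F I, ∀ p, τ p = ι (symAct g p) := by
  choose c hc hX using exists_coeff_of_fixes I ι τ hτ
  let M : Matrix (Fin n) (Fin n) F := Matrix.of fun k j => c j k
  have hM : M.det ≠ 0 := by
    intro h0
    obtain ⟨v, hv, hv0⟩ := Matrix.exists_mulVec_eq_zero_iff.2 h0
    apply hv
    have h1 : τ (∑ j, v j • MvPolynomial.X j) = τ (∑ j, (0 : Fin n → F) j • MvPolynomial.X j) := by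
      rw [map_sum]
      simp only [map_smul, hX, Finset.smul_sum, map_sum]
      rw [Finset.sum_comm]
      have h2 : ∀ k, ∑ j, v j • c j k • ι (MvPolynomial.X k) = 0 := by
        intro k
        have := congrFun hv0 k
        simp only [Matrix.mulVec, dotProduct, M, Matrix.of_apply, Pi.zero_apply] at this
        simp only [smul_smul, ← Finset.sum_smul]
        rw [Finset.sum_congr rfl fun j _ => mul_comm (v j) (c j k), this, zero_smul]
      simp only [h2]
      simp
    exact sum_smul_X_injective _ (hinj h1)
  let g : GL (Fin n) F := Matrix.GeneralLinearGroup.mkOfDetNeZero M hM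
  have hgM : (g : Matrix (Fin n) (Fin n) F) = M := rfl
  have hg : (g : Matrix (Fin n) (Fin n) F).BlockTriangular I.index := fun k j h => hc j k h
  have heq : τ = ι.comp (symAct g) := by
    ext j
    rw [hX, AlgHom.comp_apply, symAct_X, hgM]
    rfl
  refine ⟨g, ⟨hg, fun i => ?_⟩, fun p => DFunLike.congr_fun heq p⟩
  have hθ : theta F I i ∈ genAlg F I :=
    Algebra.subset_adjoin ⟨⟨i, 0, I.one_le_blocksFun i⟩, by simp [generator]⟩
  have h1 := hτ _ hθ
  rw [heq, AlgHom.comp_apply] at h1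
  have h2 := hι h1
  rw [symAct_theta hg] at h2
  have h3 := mul_right_cancel₀ (theta_ne_zero (F := F) I i) (h2.trans (one_mul _).symm)
  rw [← map_one (algebraMap F _)] at h3
  exact (algebraMap F (MvPolynomial (Fin n) F)).injective h3

theorem subalgebra_eq_top_of_X_mem {K E : Type*} [Field K] [Field E] [Algebra K E] [Algebra F K]
    [Algebra F E] [IsScalarTower F K E]
    [Algebra (MvPolynomial (Fin n) F) E] [IsScalarTower F (MvPolynomial (Fin n) F) E]
    [IsFractionRing (MvPolynomial (Fin n) F) E]
    [Algebra.IsAlgebraic K E] (T : Subalgebra K E)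
    (hT : ∀ j : Fin n, algebraMap (MvPolynomial (Fin n) F) E (MvPolynomial.X j) ∈ T) : T = ⊤ := by
  have h1 : ∀ p, algebraMap (MvPolynomial (Fin n) F) E p ∈ T := by
    intro p
    have hle : (⊤ : Subalgebra F (MvPolynomial (Fin n) F)) ≤
        (T.restrictScalars F).comap (IsScalarTower.toAlgHom F (MvPolynomial (Fin n) F) E) := by
      rw [← MvPolynomial.adjoin_range_X]
      refine Algebra.adjoin_le ?_
      rintro _ ⟨j, rfl⟩
      exact hT j
    exact hle trivial
  rw [eq_top_iff]
  rintro z -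
  obtain ⟨a, b, hb, rfl⟩ := IsFractionRing.div_surjective (MvPolynomial (Fin n) F) z
  rw [div_eq_mul_inv]
  exact T.mul_mem (h1 a) (T.inv_mem_of_algebraic (x := ⟨_, h1 b⟩)
    (Algebra.IsAlgebraic.isAlgebraic _))

/-- Invariants lie in the fraction field `K` of the algebra of generators: the fraction field `E` of
`F[x_1, …, x_n]` is a splitting field of the last vanishing polynomial over `K`, and its Galois group
acts through `K_I`. Being integral over the integrally closed algebra of generators, they lie in that
algebra. The algebra of generators, as a ring `A` of coefficients, and the two fraction fields enter as
parameters. -/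
theorem symInv_le_genAlg_of_fractionField (A K E : Type*) [CommRing A] [IsDomain A]
    [Algebra A (MvPolynomial (Fin n) F)] [Algebra.IsIntegral A (MvPolynomial (Fin n) F)]
    [IsIntegrallyClosed A] [FaithfulSMul A (MvPolynomial (Fin n) F)] [Field K] [Field E]
    [Algebra A K] [IsFractionRing A K] [Algebra (MvPolynomial (Fin n) F) E]
    [IsFractionRing (MvPolynomial (Fin n) F) E] [Algebra K E] [Algebra A E]
    [IsScalarTower A K E]
    [IsScalarTower A (MvPolynomial (Fin n) F) E]
    [Algebra F K] [Algebra F E] [IsScalarTower F K E] [IsScalarTower F (MvPolynomial (Fin n) F) E]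
    (hA : ∀ p ∈ genAlg F I, ∃ a : A, algebraMap A (MvPolynomial (Fin n) F) a = p)
    (P : A[X]) (hP : P.map (algebraMap A (MvPolynomial (Fin n) F)) = vanPoly F I I.length) :
    ∀ p ∈ symInv (groupK F I), ∃ a : A, algebraMap A (MvPolynomial (Fin n) F) a = p := by
  intro p hp
  have hSE : Function.Injective (algebraMap (MvPolynomial (Fin n) F) E) :=
    IsFractionRing.injective _ E
  have hAE : FaithfulSMul A E := by
    rw [faithfulSMul_iff_algebraMap_injective,
      IsScalarTower.algebraMap_eq A (MvPolynomial (Fin n) F) E]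
    exact hSE.comp (FaithfulSMul.algebraMap_injective _ _)
  have := (faithfulSMul_iff_algebraMap_injective A E).1 hAE
  have : Module.IsTorsionFree A E := inferInstance
  have : Algebra.IsAlgebraic A E :=
    (IsFractionRing.isAlgebraic_iff' A (MvPolynomial (Fin n) F) E).1 inferInstance
  have : Algebra.IsAlgebraic K E := (IsFractionRing.comap_isAlgebraic_iff (A := A)).1 this
  let PK := P.map (algebraMap A K)
  let ι : MvPolynomial (Fin n) F →ₐ[F] E := IsScalarTower.toAlgHom F (MvPolynomial (Fin n) F) E
  have hPE : PK.map (algebraMap K E) = ∏ c : Fin (I.sizeUpTo I.length) → F,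
      (X - C (ι (∑ t, c t • lowX F I I.length t))) := by
    rw [Polynomial.map_map, ← IsScalarTower.algebraMap_eq A K E,
      IsScalarTower.algebraMap_eq A (MvPolynomial (Fin n) F) E, ← Polynomial.map_map, hP, vanPoly,
      linProd_X_eq, Polynomial.map_prod]
    simp only [Polynomial.map_sub, Polynomial.map_X, Polynomial.map_C]
    rfl
  have hsep : PK.Separable := by
    rw [← Polynomial.separable_map (algebraMap K E), hPE]
    exact separable_prod_X_sub_C_iff.2 (hSE.comp (lowX_injective I.length))
  have : PK.IsSplittingField K E := by
    refine ⟨?_, ?_⟩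
    · rw [hPE]
      exact Splits.prod fun c _ => Splits.X_sub_C _
    · refine subalgebra_eq_top_of_X_mem (F := F) (n := n) _ fun j => Algebra.subset_adjoin ?_
      have hj : (j : ℕ) < I.sizeUpTo I.length := by rw [I.sizeUpTo_length]; exact j.2
      rw [mem_rootSet']
      refine ⟨?_, ?_⟩
      · rw [hPE]
        exact (monic_prod_of_monic _ _ fun c _ => monic_X_sub_C _).ne_zero
      · rw [aeval_def, ← eval_map, hPE, eval_prod]
        refine Finset.prod_eq_zero (Finset.mem_univ (Pi.single ⟨j, hj⟩ 1)) ?_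
        rw [sum_single_smul_lowX]
        rw [eval_sub, eval_X, eval_C]
        exact sub_eq_zero.2 rfl
  have : IsGalois K E := IsGalois.of_separable_splitting_field hsep
  have : FiniteDimensional K E := IsSplittingField.finiteDimensional E PK
  have hfix : algebraMap (MvPolynomial (Fin n) F) E p ∈ Set.range (algebraMap K E) := by
    rw [IsGalois.mem_range_algebraMap_iff_fixed]
    intro σ
    have hστ : ∀ a ∈ genAlg F I, ((σ.toAlgHom.restrictScalars F).comp ι) a = ι a := by
      intro a ha
      obtain ⟨a, rfl⟩ := hA a ha
      have h1 : ι (algebraMap A _ a) = algebraMap K E (algebraMap A K a) := by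
        rw [← IsScalarTower.algebraMap_apply A K E,
          IsScalarTower.algebraMap_apply A (MvPolynomial (Fin n) F) E]
        rfl
      rw [AlgHom.comp_apply, h1]
      exact σ.commutes _
    obtain ⟨g, hg, hgp⟩ := exists_groupK_of_fixes I ι ((σ.toAlgHom.restrictScalars F).comp ι) hSE
      (σ.injective.comp hSE) hστ
    have := hgp p
    rw [hp g hg] at this
    exact this
  obtain ⟨y, hy⟩ := hfix
  have hint : IsIntegral A y := by
    have h1 : IsIntegral A (algebraMap (MvPolynomial (Fin n) F) E p) :=
      (Algebra.IsIntegral.isIntegral (R := A) p).algebraMap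
    rw [← hy] at h1
    exact (isIntegral_algebraMap_iff (algebraMap K E).injective).1 h1
  obtain ⟨a, rfl⟩ := IsIntegrallyClosed.isIntegral_iff.1 hint
  rw [← IsScalarTower.algebraMap_apply A K E,
    IsScalarTower.algebraMap_apply A (MvPolynomial (Fin n) F) E] at hy
  exact ⟨a, hSE hy⟩

theorem symInv_le_of_integrallyClosed (A : Type*) [CommRing A] [IsDomain A] [Algebra F A]
    [Algebra A (MvPolynomial (Fin n) F)] [IsScalarTower F A (MvPolynomial (Fin n) F)]
    [Algebra.IsIntegral A (MvPolynomial (Fin n) F)]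
    [IsIntegrallyClosed A] [FaithfulSMul A (MvPolynomial (Fin n) F)]
    (hA : ∀ p ∈ genAlg F I, ∃ a : A, algebraMap A (MvPolynomial (Fin n) F) a = p)
    (P : A[X]) (hP : P.map (algebraMap A (MvPolynomial (Fin n) F)) = vanPoly F I I.length) :
    ∀ p ∈ symInv (groupK F I), ∃ a : A, algebraMap A (MvPolynomial (Fin n) F) a = p := by
  have : FaithfulSMul A (FractionRing (MvPolynomial (Fin n) F)) := by
    rw [faithfulSMul_iff_algebraMap_injective, IsScalarTower.algebraMap_eq A
      (MvPolynomial (Fin n) F) (FractionRing (MvPolynomial (Fin n) F))]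
    exact (IsFractionRing.injective (MvPolynomial (Fin n) F) _).comp
      (FaithfulSMul.algebraMap_injective _ _)
  let := FractionRing.liftAlgebra A (FractionRing (MvPolynomial (Fin n) F))
  have : IsScalarTower A (FractionRing A) (FractionRing (MvPolynomial (Fin n) F)) :=
    FractionRing.isScalarTower_liftAlgebra _ _
  have : IsScalarTower F A (FractionRing (MvPolynomial (Fin n) F)) :=
    IsScalarTower.to₁₂₄ F A (MvPolynomial (Fin n) F) _
  have : IsScalarTower F (FractionRing A) (FractionRing (MvPolynomial (Fin n) F)) :=
    IsScalarTower.to₁₃₄ F A _ _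
  exact symInv_le_genAlg_of_fractionField I A (FractionRing A)
    (FractionRing (MvPolynomial (Fin n) F)) hA P hP

theorem symInv_le_genAlg : symInv (groupK F I) ≤ genAlg F I := by
  have := isIntegral_genAlg (F := F) I
  have := isIntegrallyClosed_genAlg (F := F) I
  have : FaithfulSMul (genAlg F I) (MvPolynomial (Fin n) F) :=
    (faithfulSMul_iff_algebraMap_injective _ _).2 Subtype.val_injective
  obtain ⟨P, hP, -⟩ := exists_lift_vanPoly (F := F) I I.length le_rfl
  intro p hp
  obtain ⟨a, rfl⟩ := symInv_le_of_integrallyClosed I (genAlg F I) (fun p hp => ⟨⟨p, hp⟩, rfl⟩) P hP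
    p hp
  exact a.2

theorem symInv_groupK : symInv (groupK F I) = genAlg F I := by
  refine le_antisymm (symInv_le_genAlg I) (Algebra.adjoin_le ?_)
  rintro _ ⟨p, rfl⟩
  exact generator_mem_symInv p

end Galois

/-! ### Evaluation of forms on vectors -/

section Evaluation

variable {F : Type*} [Field F] {n : ℕ}

theorem SymExt.induction {p : SymExt F n → Prop} (zero : p 0) (add : ∀ a b, p a → p b → p (a + b))
    (tmul : ∀ f j (v : Fin j → Fin n → F), p (SymExt.tmul F f (ExteriorAlgebra.ιMulti F j v)))
    (w : SymExt F n) : p w := by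
  refine TensorProduct.induction_on (R := F) (M := MvPolynomial (Fin n) F)
    (N := ExteriorAlgebra F (Fin n → F)) (motive := p) w zero (fun f w => ?_) add
  have hw : w ∈ Submodule.span F (Set.range fun x : Σ j, (Fin j → Fin n → F) =>
      ExteriorAlgebra.ιMulti F x.1 x.2) := by
    rw [ExteriorAlgebra.ιMulti_span]; trivial
  induction hw using Submodule.span_induction generalizing f with
  | mem _ h => obtain ⟨x, rfl⟩ := h; exact tmul f x.1 x.2
  | zero => rw [TensorProduct.tmul_zero]; exact zero
  | add a b _ _ ha hb => rw [TensorProduct.tmul_add]; exact add _ _ (ha f) (hb f)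
  | smul c a _ ha => rw [← TensorProduct.smul_tmul]; exact ha _

variable {R : Type*} [CommRing R] [Algebra F R] {j : ℕ}

/-- The matrix of pairings of the vectors `r` over `R` with the vectors `v` over `F`. -/
def pairing {i : ℕ} (r : Fin j → Fin n → R) (v : Fin i → Fin n → F) : Matrix (Fin i) (Fin j) R :=
  Matrix.of fun t s => ∑ c, v t c • r s c

theorem pairing_update_right {i : ℕ} [DecidableEq (Fin i)] (r : Fin j → Fin n → R)
    (v : Fin i → Fin n → F) (t : Fin i) (z : Fin n → F) :
    pairing r (Function.update v t z) = (pairing r v).updateRow t fun s => ∑ c, z c • r s c := by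
  ext t' s
  rcases eq_or_ne t' t with rfl | h <;> simp [pairing, *]

theorem pairing_update_left {i : ℕ} [DecidableEq (Fin j)] (r : Fin j → Fin n → R)
    (v : Fin i → Fin n → F) (s : Fin j) (z : Fin n → R) :
    pairing (Function.update r s z) v = (pairing r v).updateCol s fun t => ∑ c, v t c • z c := by
  ext t s'
  rcases eq_or_ne s' s with rfl | h <;> simp [pairing, *]

/-- The determinant of the pairing with `r`, as an alternating map over `F`. -/
def detPairing (r : Fin j → Fin n → R) : (Fin n → F) [⋀^Fin j]→ₗ[F] R where
  toFun v := (pairing r v).det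
  map_update_add' {inst} v t x y := by
    obtain rfl : inst = instDecidableEqFin j := Subsingleton.elim _ _
    have h : (fun s => ∑ c, (x + y) c • r s c) =
        (fun s => ∑ c, x c • r s c) + fun s => ∑ c, y c • r s c := by
      funext s
      simp [add_smul, Finset.sum_add_distrib]
    simp only [pairing_update_right, h, Matrix.det_updateRow_add]
  map_update_smul' {inst} v t a x := by
    obtain rfl : inst = instDecidableEqFin j := Subsingleton.elim _ _
    have h : (fun s => ∑ c, (a • x) c • r s c) =
        (algebraMap F R a) • fun s => ∑ c, x c • r s c := by
      funext s
      simp [Finset.mul_sum, Algebra.smul_def, mul_assoc]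
    rw [pairing_update_right, pairing_update_right, h,
      Matrix.det_updateRow_smul, Algebra.smul_def]
  map_eq_zero_of_eq' v t t' h hne := by
    refine Matrix.det_zero_of_row_eq hne ?_
    funext s
    simp [pairing, h]

/-- The value of a form on the vectors `r`, after the change of coefficients `φ`: the product
`f ⊗ v_1 ∧ ⋯ ∧ v_j` is sent to `φ f` times the determinant of the pairing of the `v`'s with the
`r`'s, and forms of a degree other than `j` are sent to `0`. -/
def evalAt (φ : MvPolynomial (Fin n) F →ₐ[F] R) (r : Fin j → Fin n → R) : SymExt F n →ₗ[F] R :=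
  (LinearMap.mul' F R ∘ₗ TensorProduct.map φ.toLinearMap
    (ExteriorAlgebra.liftAlternating (Pi.single j (detPairing r))) :
    MvPolynomial (Fin n) F ⊗[F] ExteriorAlgebra F (Fin n → F) →ₗ[F] R)

theorem evalAt_tmul (φ : MvPolynomial (Fin n) F →ₐ[F] R) (r : Fin j → Fin n → R)
    (f : MvPolynomial (Fin n) F) (v : Fin j → Fin n → F) :
    evalAt φ r (SymExt.tmul F f (ExteriorAlgebra.ιMulti F j v)) = φ f * (pairing r v).det := by
  have h : evalAt φ r (SymExt.tmul F f (ExteriorAlgebra.ιMulti F j v)) = φ f *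
    ExteriorAlgebra.liftAlternating (Pi.single j (detPairing r))
      (ExteriorAlgebra.ιMulti F j v) := rfl
  rw [h, ExteriorAlgebra.liftAlternating_apply_ιMulti, Pi.single_eq_same]
  rfl

theorem evalAt_tmul_of_ne (φ : MvPolynomial (Fin n) F →ₐ[F] R) (r : Fin j → Fin n → R)
    (f : MvPolynomial (Fin n) F) {i : ℕ} (hij : i ≠ j) (v : Fin i → Fin n → F) :
    evalAt φ r (SymExt.tmul F f (ExteriorAlgebra.ιMulti F i v)) = 0 := by
  have h : evalAt φ r (SymExt.tmul F f (ExteriorAlgebra.ιMulti F i v)) = φ f *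
    ExteriorAlgebra.liftAlternating (Pi.single j (detPairing r))
      (ExteriorAlgebra.ιMulti F i v) := rfl
  rw [h, ExteriorAlgebra.liftAlternating_apply_ιMulti, Pi.single_eq_of_ne hij,
    AlternatingMap.zero_apply, mul_zero]

theorem evalAt_tmul_eq_zero (φ : MvPolynomial (Fin n) F →ₐ[F] R) (r : Fin j → Fin n → R)
    (f : MvPolynomial (Fin n) F) {i : ℕ} (v : Fin i → Fin n → F) (s : Fin j)
    (h : ∀ t, pairing r v t s = 0) :
    evalAt φ r (SymExt.tmul F f (ExteriorAlgebra.ιMulti F i v)) = 0 := by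
  rcases eq_or_ne i j with rfl | hij
  · rw [evalAt_tmul, Matrix.det_eq_zero_of_column_eq_zero s h, mul_zero]
  · exact evalAt_tmul_of_ne _ _ _ hij _

theorem smul_tmul (f g : MvPolynomial (Fin n) F) (w : ExteriorAlgebra F (Fin n → F)) :
    f • (SymExt.tmul F g w : SymExt F n) = SymExt.tmul F (f * g) w := rfl

theorem evalAt_smul (φ : MvPolynomial (Fin n) F →ₐ[F] R) (r : Fin j → Fin n → R)
    (f : MvPolynomial (Fin n) F) (w : SymExt F n) :
    evalAt φ r (f • w) = φ f * evalAt φ r w := by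
  induction w using SymExt.induction with
  | zero => simp
  | add x y hx hy => rw [smul_add, map_add, map_add, hx, hy, mul_add]
  | tmul g i v =>
    rw [smul_tmul]
    rcases eq_or_ne i j with rfl | h
    · rw [evalAt_tmul, evalAt_tmul, map_mul, mul_assoc]
    · rw [evalAt_tmul_of_ne _ _ _ h, evalAt_tmul_of_ne _ _ _ h, mul_zero]

theorem map_evalAt {R' : Type*} [CommRing R'] [Algebra F R'] (ψ : R →ₐ[F] R')
    (φ : MvPolynomial (Fin n) F →ₐ[F] R) (r : Fin j → Fin n → R) (w : SymExt F n) :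
    ψ (evalAt φ r w) = evalAt (ψ.comp φ) (fun s c => ψ (r s c)) w := by
  induction w using SymExt.induction with
  | zero => simp
  | add x y hx hy => rw [map_add, map_add, map_add, hx, hy]
  | tmul g i v =>
    rcases eq_or_ne i j with rfl | h
    · rw [evalAt_tmul, evalAt_tmul, map_mul, AlgHom.map_det, AlgHom.comp_apply]
      congr 2
      ext t s
      simp [pairing]
    · rw [evalAt_tmul_of_ne _ _ _ h, evalAt_tmul_of_ne _ _ _ h, map_zero]

theorem symExtAct_tmul (g : GL (Fin n) F) (f : MvPolynomial (Fin n) F) {i : ℕ}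
    (v : Fin i → Fin n → F) :
    symExtAct g (SymExt.tmul F f (ExteriorAlgebra.ιMulti F i v)) =
      SymExt.tmul F (symAct g f) (ExteriorAlgebra.ιMulti F i
        fun t => (g : Matrix (Fin n) (Fin n) F).mulVec (v t)) := by
  have h : symExtAct g (SymExt.tmul F f (ExteriorAlgebra.ιMulti F i v)) =
    SymExt.tmul F (symAct g f) (extAct g (ExteriorAlgebra.ιMulti F i v)) := rfl
  rw [h, extAct, ExteriorAlgebra.map_apply_ιMulti]
  rfl

/-- The action of `g` on forms is adjoint to the transposed action on vectors. -/
theorem evalAt_symExtAct (φ : MvPolynomial (Fin n) F →ₐ[F] R) (r : Fin j → Fin n → R)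
    (g : GL (Fin n) F) (w : SymExt F n) :
    evalAt φ r (symExtAct g w) = evalAt (φ.comp (symAct g))
      (fun s c => ∑ k, (g : Matrix (Fin n) (Fin n) F) k c • r s k) w := by
  induction w using SymExt.induction with
  | zero => simp
  | add x y hx hy => rw [map_add, map_add, map_add, hx, hy]
  | tmul f i v =>
    rw [symExtAct_tmul]
    rcases eq_or_ne i j with rfl | h
    · rw [evalAt_tmul, evalAt_tmul, AlgHom.comp_apply]
      congr 2
      ext t s
      simp only [pairing, Matrix.of_apply, Matrix.mulVec, dotProduct, Finset.sum_smul,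
        Finset.smul_sum, smul_smul]
      rw [Finset.sum_comm]
      simp only [mul_comm]
    · rw [evalAt_tmul_of_ne _ _ _ h, evalAt_tmul_of_ne _ _ _ h]

/-- The value of a form on vectors, as an alternating map in the vectors. -/
def altForm (j : ℕ) (φ : MvPolynomial (Fin n) F →ₐ[F] R) (w : SymExt F n) :
    (Fin n → R) [⋀^Fin j]→ₗ[R] R where
  toFun r := evalAt φ r w
  map_update_add' {inst} r s x y := by
    obtain rfl : inst = instDecidableEqFin j := Subsingleton.elim _ _
    induction w using SymExt.induction with
    | zero => simp
    | add a b ha hb => rw [map_add, map_add, map_add, ha, hb]; ring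
    | tmul f i v =>
      rcases eq_or_ne i j with rfl | hij
      · have h : (fun t => ∑ c, v t c • (x + y) c) =
            (fun t => ∑ c, v t c • x c) + fun t => ∑ c, v t c • y c := by
          funext t
          simp [Finset.sum_add_distrib]
        simp only [evalAt_tmul, pairing_update_left, h, Matrix.det_updateCol_add, mul_add]
      · simp only [evalAt_tmul_of_ne _ _ _ hij, add_zero]
  map_update_smul' {inst} r s a x := by
    obtain rfl : inst = instDecidableEqFin j := Subsingleton.elim _ _
    induction w using SymExt.induction with
    | zero => simp
    | add b c hb hc => rw [map_add, map_add, hb, hc, smul_add]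
    | tmul f i v =>
      rcases eq_or_ne i j with rfl | hij
      · have h : (fun t => ∑ c, v t c • (a • x) c) = a • fun t => ∑ c, v t c • x c := by
          funext t
          simp [Finset.mul_sum]
        rw [evalAt_tmul, evalAt_tmul, pairing_update_left, pairing_update_left, h,
          Matrix.det_updateCol_smul, smul_eq_mul]
        ring
      · simp only [evalAt_tmul_of_ne _ _ _ hij, smul_zero]
  map_eq_zero_of_eq' r s s' h hne := by
    induction w using SymExt.induction with
    | zero => simp
    | add b c hb hc => rw [map_add, hb, hc, add_zero]
    | tmul f i v =>
      rcases eq_or_ne i j with rfl | hij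
      · rw [evalAt_tmul, Matrix.det_zero_of_column_eq hne, mul_zero]
        intro t
        simp [pairing, h]
      · rw [evalAt_tmul_of_ne _ _ _ hij]

theorem altForm_apply (φ : MvPolynomial (Fin n) F →ₐ[F] R) (w : SymExt F n)
    (r : Fin j → Fin n → R) : altForm j φ w r = evalAt φ r w := rfl

/-- The coordinates of a form in the standard basis are its values on the standard basis vectors, so
that a form is determined by its values. -/
theorem eq_zero_of_altForm_eq_zero (w : SymExt F n)
    (h : ∀ j, altForm j (AlgHom.id F (MvPolynomial (Fin n) F)) w = 0) : w = 0 := by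
  classical
  let y : Module.Basis (Finset (Fin n)) F (ExteriorAlgebra F (Fin n → F)) :=
    (Pi.basisFun F (Fin n)).ExteriorAlgebra
  let Y : Module.Basis (Finset (Fin n)) (MvPolynomial (Fin n) F) (SymExt F n) :=
    Algebra.TensorProduct.basis (MvPolynomial (Fin n) F) y
  have hY : ∀ T, Y T = SymExt.tmul F 1 (ExteriorAlgebra.ιMulti F T.card
      fun t => Pi.single (T.orderEmbOfFin rfl t) 1) := by
    intro T
    have h1 : Y T = SymExt.tmul F 1 (y T) := Algebra.TensorProduct.basis_apply y T
    rw [h1, ExteriorAlgebra.basis_apply]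
    refine congrArg (fun v => SymExt.tmul F 1 (ExteriorAlgebra.ιMulti F T.card v)) ?_
    funext t
    exact Pi.basisFun_apply _ _ _
  refine Y.ext_elem fun T => ?_
  let L : SymExt F n →ₗ[MvPolynomial (Fin n) F] MvPolynomial (Fin n) F :=
    { toFun := fun w => evalAt (AlgHom.id F (MvPolynomial (Fin n) F))
        (fun s : Fin T.card => Pi.single (T.orderEmbOfFin rfl s) 1) w
      map_add' := fun _ _ => map_add _ _ _
      map_smul' := fun f w => evalAt_smul _ _ f w }
  have hL : Y.coord T = L := by
    refine Y.ext fun U => ?_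
    have h2 : L (Y U) = evalAt (AlgHom.id F (MvPolynomial (Fin n) F))
        (fun s : Fin T.card => Pi.single (T.orderEmbOfFin rfl s) 1) (Y U) := rfl
    rw [h2, Module.Basis.coord_apply, Module.Basis.repr_self, Finsupp.single_apply, hY]
    have h3 : ∀ (s : Fin T.card) (t : Fin U.card), pairing
        (fun s : Fin T.card => (Pi.single (T.orderEmbOfFin rfl s) 1 :
          Fin n → MvPolynomial (Fin n) F))
        (fun t => (Pi.single (U.orderEmbOfFin rfl t) 1 : Fin n → F)) t s =
        if U.orderEmbOfFin rfl t = T.orderEmbOfFin rfl s then 1 else 0 := by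
      intro s t
      simp only [pairing, Matrix.of_apply]
      rw [Finset.sum_eq_single (U.orderEmbOfFin rfl t)]
      · simp [Pi.single_apply]
      · intro c _ hc
        rw [Pi.single_eq_of_ne hc, zero_smul]
      · simp
    by_cases hc : U.card = T.card
    · split_ifs with hUT
      · subst hUT
        rw [evalAt_tmul]
        have h4 : pairing
            (fun s : Fin U.card => (Pi.single (U.orderEmbOfFin rfl s) 1 :
              Fin n → MvPolynomial (Fin n) F))
            (fun t => (Pi.single (U.orderEmbOfFin rfl t) 1 : Fin n → F)) = 1 := by
          ext t s : 2
          rw [h3]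
          simp [Matrix.one_apply]
        rw [h4, Matrix.det_one, map_one, mul_one]
      · obtain ⟨c, hcT, hcU⟩ : ∃ c ∈ T, c ∉ U := by
          by_contra! h4
          exact hUT (Finset.eq_of_subset_of_card_le h4 hc.le).symm
        obtain ⟨s, rfl⟩ : c ∈ Set.range (T.orderEmbOfFin rfl) := by simpa using hcT
        refine (evalAt_tmul_eq_zero _ _ _ _ s fun t => ?_).symm
        rw [h3, if_neg]
        intro h4
        exact hcU (h4 ▸ Finset.orderEmbOfFin_mem U rfl t)
    · rw [evalAt_tmul_of_ne _ _ _ hc, if_neg]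
      rintro rfl
      exact hc rfl
  have h3 := h T.card
  rw [← Module.Basis.coord_apply, hL, map_zero]
  exact DFunLike.congr_fun h3 fun s => Pi.single (T.orderEmbOfFin rfl s) 1

/-- An alternating map vanishing on all increasing families of columns of a matrix with nonzero
determinant is zero. -/
theorem alternatingMap_eq_zero {D : Type*} [CommRing D] [IsDomain D] {m j : ℕ}
    (N : Matrix (Fin m) (Fin m) D) (hN : N.det ≠ 0) (T : (Fin m → D) [⋀^Fin j]→ₗ[D] D)
    (h : ∀ a : Fin j → Fin m, StrictMono a → T (fun s => N (a s)) = 0) : T = 0 := by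
  have h1 : ∀ a : Fin j → Fin m, Function.Injective a → T (fun s => N (a s)) = 0 := by
    intro a ha
    have h2 := h (a ∘ Tuple.sort a)
      ((Tuple.monotone_sort a).strictMono_of_injective (ha.comp (Tuple.sort a).injective))
    have h3 := T.map_perm (fun s => N (a s)) (Tuple.sort a)
    have h4 : (fun s => N ((a ∘ Tuple.sort a) s)) = (fun s => N (a s)) ∘ Tuple.sort a := rfl
    rw [h4, h3] at h2
    rcases Int.units_eq_one_or (Equiv.Perm.sign (Tuple.sort a)) with h5 | h5 <;>
      simpa [h5] using h2
  have h2 : T.compLinearMap (Matrix.toLin' Nᵀ) = 0 := by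
    refine Module.Basis.ext_alternating (Pi.basisFun D (Fin m)) fun a ha => ?_
    rw [AlternatingMap.compLinearMap_apply, AlternatingMap.zero_apply, ← h1 a ha]
    congr 1
    funext s
    simp
    rfl
  ext v
  have h3 := DFunLike.congr_fun h2 fun s => (N.adjugateᵀ).mulVec (v s)
  rw [AlternatingMap.compLinearMap_apply] at h3
  have h4 : (fun s => Matrix.toLin' Nᵀ ((N.adjugateᵀ).mulVec (v s))) = fun s => N.det • v s := by
    funext s
    rw [Matrix.toLin'_apply, Matrix.mulVec_mulVec, ← Matrix.transpose_mul, Matrix.adjugate_mul,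
      Matrix.transpose_smul, Matrix.transpose_one, Matrix.smul_mulVec, Matrix.one_mulVec]
  have h5 := T.map_smul_univ (fun _ => N.det) v
  simp only [h4] at h3
  rw [h3] at h5
  simpa [hN] using h5.symm

end Evaluation

/-! ### Values of Mui's elements -/

section Values

/-- Every permutation is, in exactly one way, a permutation increasing on the first `j` positions
precomposed with a permutation of these positions. -/
theorem sum_perm_eq_sum_increasing {M : Type*} [AddCommMonoid M] {j k : ℕ}
    (T : Equiv.Perm (Fin (j + k)) → M) :
    ∑ σ, T σ = ∑ σ : Equiv.Perm (Fin (j + k)) with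
        ∀ r s : Fin (j + k), r < s → (s : ℕ) < j → σ r < σ s,
      ∑ π : Equiv.Perm (Fin j),
        T (σ * π.extendDomain (Fin.castLEquiv (Nat.le_add_right j k))) := by
  set E : Equiv.Perm (Fin j) → Equiv.Perm (Fin (j + k)) := fun π =>
    π.extendDomain (Fin.castLEquiv (Nat.le_add_right j k)) with hE
  have hE1 : ∀ π (r : Fin j), E π (Fin.castLE (Nat.le_add_right j k) r) =
      Fin.castLE (Nat.le_add_right j k) (π r) := fun π r =>
    Equiv.Perm.extendDomain_apply_image π (Fin.castLEquiv (Nat.le_add_right j k)) r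
  have hEm : ∀ π π', E π * E π' = E (π * π') := fun π π' =>
    Equiv.Perm.extendDomain_mul _ _ _
  have hE0 : E 1 = 1 := Equiv.Perm.extendDomain_one _
  have hmono : ∀ σ : Equiv.Perm (Fin (j + k)),
      (∀ r s : Fin (j + k), r < s → (s : ℕ) < j → σ r < σ s) ↔
      StrictMono fun r : Fin j => σ (Fin.castLE (Nat.le_add_right j k) r) := by
    intro σ
    constructor
    · intro h r s hrs
      exact h _ _ hrs s.2
    · intro h r s hrs hs
      have hr : (r : ℕ) < j := lt_trans hrs hs
      exact h (a := ⟨r, hr⟩) (b := ⟨s, hs⟩) hrs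
  rw [← Finset.sum_product']
  let S : Equiv.Perm (Fin (j + k)) → Equiv.Perm (Fin j) := fun σ =>
    Tuple.sort fun r : Fin j => σ (Fin.castLE (Nat.le_add_right j k) r)
  have hinj : ∀ σ : Equiv.Perm (Fin (j + k)), Function.Injective
      fun r : Fin j => σ (Fin.castLE (Nat.le_add_right j k) r) := fun σ =>
    σ.injective.comp (Fin.castLE_injective _)
  refine (Finset.sum_bij' (fun p _ => p.1 * E p.2) (fun σ _ => (σ * E (S σ), (S σ)⁻¹))
    ?_ ?_ ?_ ?_ ?_).symm
  · intro p _; exact Finset.mem_univ _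
  · intro σ _
    refine Finset.mem_product.2 ⟨Finset.mem_filter.2 ⟨Finset.mem_univ _, ?_⟩, Finset.mem_univ _⟩
    rw [hmono]
    simp only [Equiv.Perm.mul_apply, hE1]
    exact (Tuple.monotone_sort
      fun r : Fin j => σ (Fin.castLE (Nat.le_add_right j k) r)).strictMono_of_injective
      ((hinj σ).comp (S σ).injective)
  · rintro ⟨σ, π⟩ hp
    have hσ : StrictMono fun r : Fin j => σ (Fin.castLE (Nat.le_add_right j k) r) :=
      (hmono σ).1 (Finset.mem_filter.1 (Finset.mem_product.1 hp).1).2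
    have hS : S (σ * E π) = π⁻¹ := by
      apply Equiv.ext
      intro r
      apply hinj (σ * E π)
      have := Tuple.unique_monotone
        (f := fun r : Fin j => (σ * E π) (Fin.castLE (Nat.le_add_right j k) r))
        (Tuple.monotone_sort _) (τ := π⁻¹) (by
          have : (fun r : Fin j => (σ * E π) (Fin.castLE (Nat.le_add_right j k) r)) ∘ ⇑(π⁻¹) =
              fun r : Fin j => σ (Fin.castLE (Nat.le_add_right j k) r) := by
            funext r
            simp [hE1]
          rw [this]
          exact hσ.monotone)
      exact congrFun this r
    simp only [hS, mul_assoc, hEm, mul_inv_cancel, hE0, mul_one, inv_inv]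
  · intro σ _
    simp only [mul_assoc, hEm, mul_inv_cancel, hE0, mul_one]
  · intro p _
    rfl

variable {F : Type*} [Field F] {n : ℕ}

theorem list_prod_symX {k : ℕ} (f : Fin k → Fin n) (e : Fin k → ℕ) :
    (List.ofFn fun p => (symX F (f p) : SymExt F n) ^ e p).prod =
      SymExt.tmul F (∏ p, MvPolynomial.X (f p) ^ e p) 1 := by
  have h : ∀ l : List (MvPolynomial (Fin n) F),
      (SymExt.tmul F l.prod 1 : SymExt F n) = (l.map fun p => SymExt.tmul F p 1).prod := by
    intro l
    exact map_list_prod (Algebra.TensorProduct.includeLeft :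
      MvPolynomial (Fin n) F →ₐ[F]
        (MvPolynomial (Fin n) F ⊗[F] ExteriorAlgebra F (Fin n → F))) l
  rw [← List.prod_ofFn, h, List.map_ofFn]
  congr 2
  funext p
  exact (map_pow (Algebra.TensorProduct.includeLeft :
      MvPolynomial (Fin n) F →ₐ[F]
        (MvPolynomial (Fin n) F ⊗[F] ExteriorAlgebra F (Fin n → F))) _ _).symm

theorem tmul_mul_tmul_one (f : MvPolynomial (Fin n) F) (w : ExteriorAlgebra F (Fin n → F)) :
    (SymExt.tmul F 1 w * SymExt.tmul F f 1 : SymExt F n) = SymExt.tmul F f w := by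
  have h := Algebra.TensorProduct.tmul_mul_tmul (R := F) (1 : MvPolynomial (Fin n) F) f w 1
  rw [one_mul, mul_one] at h
  exact h

/-- The exponents of the Frobenius rows of Mui's matrix, preceded by the numbers `a`. -/
def rowExp {j : ℕ} (a b : Fin j → ℕ) {m : ℕ} (p : Fin m) : ℕ :=
  if h : (p : ℕ) < j then a ⟨p, h⟩ else Nat.nth (fun e => e ∉ Set.range b) (p - j)

theorem prod_muiMatrix (q : ℕ) {j k : ℕ} (b : Fin j → ℕ) (f : Fin (j + k) → Fin n)
    (σ : Equiv.Perm (Fin (j + k))) :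
    (List.ofFn fun r => muiMatrix q b (fun t => symX F (f t)) (fun t => extY F (f t)) r
      (σ r)).prod = SymExt.tmul F
        (∏ p : Fin k, MvPolynomial.X (f (σ (Fin.natAdd j p))) ^ q ^
          Nat.nth (fun e => e ∉ Set.range b) p)
        (ExteriorAlgebra.ιMulti F j fun s =>
          Pi.single (f (σ (Fin.castLE (Nat.le_add_right j k) s))) 1) := by
  rw [List.ofFn_add, List.prod_append]
  have h1 : ∀ r : Fin j, muiMatrix q b (fun t => symX F (f t)) (fun t => extY F (f t))
      (Fin.castLE (Nat.le_add_right j k) r) (σ (Fin.castLE (Nat.le_add_right j k) r)) =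
      extY F (f (σ (Fin.castLE (Nat.le_add_right j k) r))) := fun r => by
    simp [muiMatrix]
  have h2 : ∀ r : Fin k, muiMatrix q b (fun t => symX F (f t)) (fun t => extY F (f t))
      (Fin.natAdd j r) (σ (Fin.natAdd j r)) =
      symX F (f (σ (Fin.natAdd j r))) ^ q ^ Nat.nth (fun e => e ∉ Set.range b) r := fun r => by
    simp [muiMatrix]
  simp only [h1, h2]
  rw [prod_extY, list_prod_symX, tmul_mul_tmul_one]

/-- Laplace expansion: evaluating Mui's element on vectors replaces the rows `y` by these
vectors. -/
theorem evalAt_mui (q : ℕ) {m j : ℕ} (hm : m ≤ n) (hj : j ≤ m) (b : Fin j → ℕ)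
    (r : Fin j → Fin n → MvPolynomial (Fin n) F) :
    evalAt (AlgHom.id F (MvPolynomial (Fin n) F)) r (mui F q hm b) =
      (Matrix.of fun p c : Fin m => if h : (p : ℕ) < j then r ⟨p, h⟩ (Fin.castLE hm c) else
        MvPolynomial.X (Fin.castLE hm c) ^ q ^
          Nat.nth (fun e => e ∉ Set.range b) (p - j)).det := by
  obtain ⟨k, rfl⟩ := Nat.exists_eq_add_of_le hj
  rw [← Matrix.det_transpose, Matrix.det_apply, sum_perm_eq_sum_increasing, mui,
    rowDetDivFactorial, map_sum]
  refine Finset.sum_congr rfl fun σ _ => ?_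
  rw [map_zsmul, prod_muiMatrix, evalAt_tmul, Matrix.det_apply, Finset.mul_sum, Finset.smul_sum]
  refine Finset.sum_congr rfl fun π _ => ?_
  have h1 : ∀ r : Fin j, π.extendDomain (Fin.castLEquiv (Nat.le_add_right j k))
      (Fin.castLE (Nat.le_add_right j k) r) = Fin.castLE (Nat.le_add_right j k) (π r) := fun r =>
    Equiv.Perm.extendDomain_apply_image π (Fin.castLEquiv (Nat.le_add_right j k)) r
  have h2 : ∀ r : Fin k, π.extendDomain (Fin.castLEquiv (Nat.le_add_right j k))
      (Fin.natAdd j r) = Fin.natAdd j r := fun r =>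
    Equiv.Perm.extendDomain_apply_not_subtype _ _ (by simp)
  have h3 : ∀ (v : Fin n) (s : Fin j), ∑ c, (Pi.single v 1 : Fin n → F) c • r s c = r s v := by
    intro v s
    rw [Finset.sum_eq_single v]
    · simp
    · intro c _ hc
      rw [Pi.single_eq_of_ne hc, zero_smul]
    · simp
  have h4 : ∀ s : Fin j, Fin.castAdd k s = Fin.castLE (Nat.le_add_right j k) s := fun _ => rfl
  rw [Equiv.Perm.sign_mul, Equiv.Perm.sign_extendDomain, Fin.prod_univ_add]
  simp only [Matrix.transpose_apply, Matrix.of_apply, Equiv.Perm.mul_apply, h1, h2, h4, pairing,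
    h3, Fin.val_castLE, Fin.is_lt, dif_pos, Fin.val_natAdd, Nat.add_sub_cancel_left,
    AlgHom.id_apply]
  have h5 : ∀ x : Fin k, ¬ (j + (x : ℕ) < j) := fun x => by omega
  simp only [h5, dif_neg, not_false_eq_true]
  simp only [Units.smul_def, zsmul_eq_mul, Units.val_mul, Int.cast_mul]
  ring

theorem evalAt_mui_of_ne (q : ℕ) {m i j : ℕ} (hm : m ≤ n) (hj : j ≤ m) (b : Fin j → ℕ)
    (hij : j ≠ i) (r : Fin i → Fin n → MvPolynomial (Fin n) F) :
    evalAt (AlgHom.id F (MvPolynomial (Fin n) F)) r (mui F q hm b) = 0 := by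
  obtain ⟨k, rfl⟩ := Nat.exists_eq_add_of_le hj
  rw [mui, rowDetDivFactorial, map_sum]
  refine Finset.sum_eq_zero fun σ _ => ?_
  rw [map_zsmul, prod_muiMatrix, evalAt_tmul_of_ne _ _ _ hij, smul_zero]

section RowExp

variable {m j : ℕ} {b : Fin j → ℕ}

theorem rowExp_lt (hb : StrictMono b) (hbm : ∀ t, b t < m) (p : Fin m) : rowExp b b p < m := by
  classical
  rw [rowExp]
  split_ifs with h
  · exact hbm _
  · apply Nat.nth_lt_of_lt_count
    rw [Nat.count_eq_card_filter_range]
    have h1 : (Finset.range m).filter (fun e => e ∉ Set.range b) =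
        Finset.range m \ Finset.univ.image b := by
      ext e
      simp
    rw [h1, Finset.card_sdiff_of_subset, Finset.card_image_of_injective _ hb.injective]
    · simp only [Finset.card_range, Finset.card_univ, Fintype.card_fin]
      omega
    · intro e he
      obtain ⟨t, -, rfl⟩ := Finset.mem_image.1 he
      exact Finset.mem_range.2 (hbm t)

theorem infinite_compl_range (b : Fin j → ℕ) : {e | e ∉ Set.range b}.Infinite :=
  (Set.finite_range b).infinite_compl

theorem rowExp_injective (hb : StrictMono b) : Function.Injective (rowExp b b : Fin m → ℕ) := by
  have hnth : ∀ k, Nat.nth (fun e => e ∉ Set.range b) k ∉ Set.range b := fun k =>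
    Nat.nth_mem_of_infinite (infinite_compl_range b) k
  intro p p' h
  rw [rowExp, rowExp] at h
  ext
  split_ifs at h with h1 h2 h2
  · simpa using hb.injective h
  · exact absurd ⟨_, h⟩ (hnth _)
  · exact absurd ⟨_, h.symm⟩ (hnth _)
  · have := Nat.nth_injective (infinite_compl_range b) h
    omega

/-- The permutation listing `b` first and its complement in `{0, …, m - 1}` afterwards. -/
theorem exists_perm_rowExp (hb : StrictMono b) (hbm : ∀ t, b t < m) :
    ∃ σ : Equiv.Perm (Fin m), ∀ p, rowExp b b p = (σ p : ℕ) := by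
  let f : Fin m → Fin m := fun p => ⟨rowExp b b p, rowExp_lt hb hbm p⟩
  have hf : Function.Injective f := fun p p' h => rowExp_injective hb (congrArg Fin.val h)
  exact ⟨Equiv.ofBijective f (Finite.injective_iff_bijective.1 hf), fun p => rfl⟩

theorem exists_rowExp_eq (hb : StrictMono b) (hbm : ∀ t, b t < m) {e : ℕ} (he : e < m)
    (heb : e ∉ Set.range b) : ∃ p : Fin m, j ≤ p ∧ ∀ a : Fin j → ℕ, rowExp a b p = e := by
  obtain ⟨σ, hσ⟩ := exists_perm_rowExp hb hbm
  have h1 : rowExp b b (σ.symm ⟨e, he⟩) = e := by rw [hσ]; simp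
  by_cases h : (σ.symm ⟨e, he⟩ : ℕ) < j
  · rw [rowExp, dif_pos h] at h1
    exact absurd ⟨_, h1⟩ heb
  · refine ⟨σ.symm ⟨e, he⟩, not_lt.1 h, fun a => ?_⟩
    rw [rowExp, dif_neg h] at h1 ⊢
    exact h1

end RowExp

theorem exists_notMem_range_of_ne {j : ℕ} {a b : Fin j → ℕ} (ha : StrictMono a) (hb : StrictMono b)
    (hab : a ≠ b) : ∃ s, a s ∉ Set.range b := by
  classical
  by_contra! h
  apply hab
  have h1 : Finset.univ.image a ⊆ Finset.univ.image b := by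
    intro e he
    obtain ⟨s, -, rfl⟩ := Finset.mem_image.1 he
    obtain ⟨t, ht⟩ := h s
    exact Finset.mem_image.2 ⟨t, Finset.mem_univ _, ht⟩
  have h2 := Finset.eq_of_subset_of_card_le h1 (by
    rw [Finset.card_image_of_injective _ ha.injective,
      Finset.card_image_of_injective _ hb.injective])
  rw [← ha.range_inj hb]
  have := congrArg (fun s : Finset ℕ => (s : Set ℕ)) h2
  simpa using this

end Values

/-! ### Frobenius vectors and the duality with Mui's elements -/

section Frobenius

variable {F : Type*} [Field F] [Fintype F] {n j : ℕ}

variable (F) in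
/-- The vector `(x_1^(q^e), …, x_n^(q^e))`, that is, the `GL_n(q)`-invariant vector field
`∑_c x_c^(q^e) ∂/∂x_c`. -/
def frobVec (e : ℕ) (c : Fin n) : MvPolynomial (Fin n) F :=
  MvPolynomial.X c ^ Fintype.card F ^ e

/-- The value of a form on the Frobenius vectors with exponents `a`. -/
def frobVal (a : Fin j → ℕ) : SymExt F n →ₗ[F] MvPolynomial (Fin n) F :=
  evalAt (AlgHom.id F _) fun s => frobVec F (a s)

theorem frobVal_smul (a : Fin j → ℕ) (f : MvPolynomial (Fin n) F) (w : SymExt F n) :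
    frobVal a (f • w) = f * frobVal a w := evalAt_smul _ _ f w

theorem map_frobVal (φ : MvPolynomial (Fin n) F →ₐ[F] MvPolynomial (Fin n) F) (a : Fin j → ℕ)
    (w : SymExt F n) : φ (frobVal a w) = altForm j φ w fun s c => φ (frobVec F (a s) c) :=
  map_evalAt φ (AlgHom.id F _) _ w

theorem frobVal_symExtAct (a : Fin j → ℕ) (g : GL (Fin n) F) (w : SymExt F n) :
    frobVal a (symExtAct g w) = symAct g (frobVal a w) := by
  rw [frobVal, evalAt_symExtAct, map_evalAt]
  refine congrArg (fun r => evalAt (symAct g) r w) ?_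
  funext s c
  rw [frobVec, map_pow, symAct_X, sum_smul_pow_card]
  rfl

theorem frobVal_mem_symInv {G : Subgroup (GL (Fin n) F)} {w : SymExt F n}
    (hw : w ∈ symExtInv G) (a : Fin j → ℕ) : frobVal a w ∈ symInv G := fun g hg => by
  rw [← frobVal_symExtAct, hw g hg]

theorem det_frobVec_ne_zero :
    (Matrix.of fun r c : Fin n => frobVec F (r : ℕ) c).det ≠ 0 := by
  have h : (moore F (MvPolynomial.X : Fin n → MvPolynomial (Fin n) F)).det ≠ 0 := by
    rw [det_moore]
    exact prodL_X_ne_zero F n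
  exact h

/-- The first `n` Frobenius vectors form a basis over the field of fractions, so a form is
determined by its values on them. -/
theorem eq_zero_of_frobVal_eq_zero (w : SymExt F n)
    (h : ∀ j (a : Fin j → ℕ), StrictMono a → (∀ t, a t < n) → frobVal a w = 0) : w = 0 := by
  refine eq_zero_of_altForm_eq_zero w fun j => ?_
  refine alternatingMap_eq_zero (Matrix.of fun r c : Fin n => frobVec F (r : ℕ) c)
    det_frobVec_ne_zero _ fun a ha => ?_
  exact h j (fun s => (a s : ℕ)) ha fun t => (a t).2

theorem frobVal_one_of_zero (a : Fin 0 → ℕ) : frobVal a (1 : SymExt F n) = 1 := by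
  have h : (1 : SymExt F n) = SymExt.tmul F 1 (ExteriorAlgebra.ιMulti F 0 ![]) := by
    rw [ExteriorAlgebra.ιMulti_zero_apply]
    rfl
  rw [h, frobVal, evalAt_tmul]
  simp

theorem frobVal_mui {m : ℕ} (hm : m ≤ n) (hj : j ≤ m) (a b : Fin j → ℕ) :
    frobVal a (mui F (Fintype.card F) hm b) = (Matrix.of fun p c : Fin m =>
      (MvPolynomial.X (Fin.castLE hm c) : MvPolynomial (Fin n) F) ^
        Fintype.card F ^ rowExp a b p).det := by
  rw [frobVal, evalAt_mui _ _ hj]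
  congr 1
  ext p c : 2
  simp only [Matrix.of_apply, rowExp]
  split_ifs <;> rfl

/-- The determinant has a repeated row. -/
theorem frobVal_mui_of_ne {m : ℕ} (hm : m ≤ n) (hj : j ≤ m) {a b : Fin j → ℕ} (ha : StrictMono a)
    (hb : StrictMono b) (ham : ∀ t, a t < m) (hbm : ∀ t, b t < m) (hab : a ≠ b) :
    frobVal a (mui F (Fintype.card F) hm b) = 0 := by
  obtain ⟨s, hs⟩ := exists_notMem_range_of_ne ha hb hab
  obtain ⟨p, hp, hpe⟩ := exists_rowExp_eq hb hbm (ham s) hs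
  have hsm : (s : ℕ) < m := lt_of_lt_of_le s.2 hj
  have hne : (⟨s, hsm⟩ : Fin m) ≠ p := by
    rintro rfl
    exact absurd s.2 (not_lt.2 hp)
  rw [frobVal_mui hm hj]
  refine Matrix.det_zero_of_row_eq hne ?_
  funext c
  simp only [Matrix.of_apply, hpe]
  rw [rowExp, dif_pos s.2]

/-- Up to the order of its rows, the determinant is a Moore determinant. -/
theorem frobVal_mui_self {m : ℕ} (hm : m ≤ n) (hj : j ≤ m) {b : Fin j → ℕ}
    (hb : StrictMono b) (hbm : ∀ t, b t < m) : ∃ ε : ℤˣ,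
    frobVal b (mui F (Fintype.card F) hm b) = ((ε : ℤ) : MvPolynomial (Fin n) F) *
      prodL F fun t : Fin m => (MvPolynomial.X (Fin.castLE hm t) : MvPolynomial (Fin n) F) := by
  obtain ⟨σ, hσ⟩ := exists_perm_rowExp hb hbm
  refine ⟨Equiv.Perm.sign σ, ?_⟩
  rw [frobVal_mui hm hj, ← det_moore, ← Matrix.det_permute]
  congr 1
  ext p c : 2
  simp only [Matrix.of_apply, hσ, moore, Matrix.submatrix_apply, id]

variable {I : Composition n}

theorem prodL_lowX_ne_zero (i : ℕ) : prodL F (lowX F I i) ≠ 0 := by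
  have h := map_prodL (F := F) (MvPolynomial.rename (Fin.castLE (I.sizeUpTo_le i)))
    (MvPolynomial.X : Fin (I.sizeUpTo i) → MvPolynomial (Fin (I.sizeUpTo i)) F)
  simp only [MvPolynomial.rename_X] at h
  intro h0
  apply prodL_X_ne_zero F (I.sizeUpTo i)
  apply MvPolynomial.rename_injective _ (Fin.castLE_injective (I.sizeUpTo_le i))
  rw [map_zero, ← h0]
  exact h

theorem prodL_lowX_mem_symInv (i : ℕ) (hi : i ≤ I.length) :
    prodL F (lowX F I i) ∈ symInv (groupK F I) := by
  rintro g ⟨hg, hg'⟩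
  rw [map_prodL, symAct_lowX hg, prodL_linSubst, det_leading_eq_one hg hg' i hi, map_one, one_mul]

/-- The values of `M_{m_i;b}` on Frobenius vectors are determinants in `x_1, …, x_{m_i}`, which are
multiplied by the determinant of the leading submatrix of size `m_i`, that is, by `1`. -/
theorem muiElement_mem_symExtInv (d : MuiIndex I) :
    muiElement F d ∈ symExtInv (groupK F I) := by
  rintro g ⟨hg, hg'⟩
  rw [← sub_eq_zero]
  refine eq_zero_of_frobVal_eq_zero _ fun j a _ _ => ?_
  rw [map_sub, frobVal_symExtAct, muiElement]
  rcases eq_or_ne d.j j with rfl | hj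
  · have h := symAct_lowX hg (d.i + 1)
    rw [frobVal_mui _ d.le_size, AlgHom.map_det, sub_eq_zero]
    have h2 := det_pow_linSubst (leading I (d.i + 1) (g : Matrix (Fin n) (Fin n) F))
      (lowX F I (d.i + 1)) (rowExp a d.b)
    rw [det_leading_eq_one hg hg' _ d.i.2, map_one, one_mul, ← h] at h2
    refine Eq.trans (congrArg Matrix.det ?_) h2
    ext p c : 2
    simp [lowX]
  · rw [frobVal, evalAt_mui_of_ne _ _ d.le_size _ hj, map_zero, sub_zero]

end Frobenius

/-! ### Divisibility of the values of invariant forms -/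

section Divisibility

variable {F : Type*} [Field F] {n : ℕ}

/-- The substitution `x_k ↦ 0`. -/
def killVar (k : Fin n) : MvPolynomial (Fin n) F →ₐ[F] MvPolynomial (Fin n) F :=
  MvPolynomial.aeval fun c => if c = k then 0 else MvPolynomial.X c

theorem killVar_X_self (k : Fin n) : killVar k (MvPolynomial.X k : MvPolynomial (Fin n) F) = 0 := by
  simp [killVar]

theorem killVar_X_of_ne {k c : Fin n} (h : c ≠ k) :
    killVar k (MvPolynomial.X c : MvPolynomial (Fin n) F) = MvPolynomial.X c := by
  simp [killVar, h]

theorem X_dvd_sub_killVar (k : Fin n) (p : MvPolynomial (Fin n) F) :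
    MvPolynomial.X k ∣ p - killVar k p := by
  induction p using MvPolynomial.induction_on with
  | C a =>
    rw [← MvPolynomial.algebraMap_eq, AlgHom.commutes, sub_self]
    exact dvd_zero _
  | add p q hp hq =>
    rw [map_add, add_sub_add_comm]
    exact dvd_add hp hq
  | mul_X p c hp =>
    rw [map_mul]
    rcases eq_or_ne c k with rfl | h
    · rw [killVar_X_self, mul_zero, sub_zero]
      exact dvd_mul_left _ _
    · rw [killVar_X_of_ne h, ← sub_mul]
      exact hp.mul_right _

theorem X_dvd_of_killVar_eq_zero {k : Fin n} {p : MvPolynomial (Fin n) F} (h : killVar k p = 0) :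
    MvPolynomial.X k ∣ p := by
  have := X_dvd_sub_killVar k p
  rwa [h, sub_zero] at this

variable {I : Composition n}

theorem exists_transvection_mem {k c : Fin n} (hck : c ≠ k) (hi : I.index k ≤ I.index c) :
    ∃ g ∈ groupK F I, (g : Matrix (Fin n) (Fin n) F) = Matrix.transvection k c 1 := by
  have hdet : (Matrix.transvection k c (1 : F)).det = 1 :=
    Matrix.det_transvection_of_ne k c hck.symm 1
  refine ⟨Matrix.GeneralLinearGroup.mkOfDetNeZero (Matrix.transvection k c 1)
    (by rw [hdet]; exact one_ne_zero), ⟨?_, fun i => ?_⟩, rfl⟩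
  · change (Matrix.transvection k c (1 : F)).BlockTriangular I.index
    intro r c' h
    have h1 : r ≠ c' := by rintro rfl; exact lt_irrefl _ h
    have h2 : ¬ (k = r ∧ c = c') := by
      rintro ⟨rfl, rfl⟩
      exact absurd h (not_lt.2 hi)
    simp [Matrix.transvection, h1, h2]
  · change ((Matrix.transvection k c (1 : F)).submatrix (I.embedding i) (I.embedding i)).det = 1
    by_cases h : I.index k = i ∧ I.index c = i
    · obtain ⟨rfl, h2⟩ := h
      obtain ⟨c', rfl⟩ : ∃ c', I.embedding (I.index k) c' = c := by
        rw [← h2]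
        exact ⟨_, I.embedding_comp_inv c⟩
      have hk : I.embedding (I.index k) (I.invEmbedding k) = k := I.embedding_comp_inv k
      have h3 : (Matrix.transvection k (I.embedding (I.index k) c') (1 : F)).submatrix
          (I.embedding (I.index k)) (I.embedding (I.index k)) =
          Matrix.transvection (I.invEmbedding k) c' 1 := by
        ext a b
        have h4 : k = I.embedding (I.index k) a ↔ I.invEmbedding k = a := by
          constructor
          · exact fun h => (I.embedding _).injective (hk.trans h)
          · rintro rfl
            exact hk.symm
        simp [Matrix.transvection, Matrix.single_apply, Matrix.one_apply, h4]
      rw [h3, Matrix.det_transvection_of_ne]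
      rintro h5
      rw [← h5, hk] at hck
      exact hck rfl
    · have h3 : (Matrix.transvection k c (1 : F)).submatrix (I.embedding i) (I.embedding i) = 1 := by
        ext a b
        have h4 : ¬ (k = I.embedding i a ∧ c = I.embedding i b) := by
          rintro ⟨rfl, rfl⟩
          exact h ⟨I.index_embedding _ _, I.index_embedding _ _⟩
        simp [Matrix.transvection, Matrix.one_apply, h4]
      rw [h3, Matrix.det_one]

/-- Modulo `x_k`, the transvection `x_c ↦ x_c + x_k` acts trivially on polynomials but replaces
`y_c` by `y_c + y_k`; so an invariant form vanishes on the `c`-th basis vector and vectors without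
`k`-th component. -/
theorem altForm_killVar_update {w : SymExt F n} (hw : w ∈ symExtInv (groupK F I)) {k c : Fin n}
    (hck : c ≠ k) (hi : I.index k ≤ I.index c) {j : ℕ} (v : Fin j → Fin n → MvPolynomial (Fin n) F)
    (hv : ∀ t, v t k = 0) (s : Fin j) :
    altForm j (killVar k) w (Function.update v s (Pi.single c 1)) = 0 := by
  obtain ⟨g, hg, hgM⟩ := exists_transvection_mem (F := F) hck hi
  have hent : ∀ r c', (g : Matrix (Fin n) (Fin n) F) r c' =
      (if r = c' then 1 else 0) + if k = r ∧ c = c' then 1 else 0 := by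
    intro r c'
    rw [hgM]
    simp [Matrix.transvection, Matrix.single_apply, Matrix.one_apply]
  have hsum : ∀ (x : Fin n → MvPolynomial (Fin n) F) c',
      ∑ r, (g : Matrix (Fin n) (Fin n) F) r c' • x r = x c' + if c = c' then x k else 0 := by
    intro x c'
    simp only [hent, add_smul, Finset.sum_add_distrib, ite_smul, one_smul, zero_smul, ite_and]
    simp
  have hφ : (killVar k).comp (symAct g) = killVar (F := F) k := by
    ext c' : 1
    rw [AlgHom.comp_apply, symAct_X, hsum, map_add]
    split_ifs
    · rw [killVar_X_self, add_zero]
    · rw [map_zero, add_zero]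
  have h1 := evalAt_symExtAct (killVar k) (Function.update v s (Pi.single k 1)) g w
  rw [hw g hg, hφ] at h1
  have h2 : (fun t c' => ∑ r, (g : Matrix (Fin n) (Fin n) F) r c' •
      Function.update v s (Pi.single k 1 : Fin n → MvPolynomial (Fin n) F) t r) =
      Function.update v s (Pi.single k 1 + Pi.single c 1) := by
    funext t c'
    rw [hsum]
    rcases eq_or_ne t s with rfl | hts
    · simp [Pi.single_apply, eq_comm]
    · simp [hts, hv]
  rw [h2, ← altForm_apply, ← altForm_apply, AlternatingMap.map_update_add] at h1
  exact left_eq_add.1 h1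

variable [Fintype F]

/-- If an invariant form vanishes on the Frobenius vectors with exponents below the block of `x_k`,
then all its values on Frobenius vectors are divisible by `x_k`: modulo `x_k` it only depends on the
components of the vectors in the preceding blocks, and these are combinations of the Frobenius
vectors considered. -/
theorem X_dvd_frobVal {w : SymExt F n} (hw : w ∈ symExtInv (groupK F I)) (k : Fin n)
    (h0 : ∀ j (a : Fin j → ℕ), StrictMono a → (∀ t, a t < I.sizeUpTo (I.index k)) →
      frobVal a w = 0) {j : ℕ} (a : Fin j → ℕ) : MvPolynomial.X k ∣ frobVal a w := by
  set m := I.sizeUpTo (I.index k) with hm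
  have hmn : m ≤ n := I.sizeUpTo_le _
  have hkm : m ≤ (k : ℕ) := I.sizeUpTo_index_le k
  set S := MvPolynomial (Fin n) F
  let T := altForm j (killVar k) w
  -- `A` deletes the `k`-th component, `B ∘ P` all components outside of the preceding blocks
  let A : (Fin n → S) →ₗ[S] (Fin n → S) :=
    LinearMap.pi fun c => if c = k then 0 else LinearMap.proj c
  let P : (Fin n → S) →ₗ[S] (Fin m → S) := LinearMap.pi fun c => LinearMap.proj (Fin.castLE hmn c)
  let B : (Fin m → S) →ₗ[S] (Fin n → S) :=
    LinearMap.pi fun c => if h : (c : ℕ) < m then LinearMap.proj ⟨c, h⟩ else 0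
  have hA : ∀ v c, A v c = if c = k then 0 else v c := by
    intro v c
    simp only [A, LinearMap.pi_apply]
    split_ifs <;> simp
  have hBP : ∀ v c, B (P v) c = if (c : ℕ) < m then v c else 0 := by
    intro v c
    simp only [B, P, LinearMap.pi_apply]
    split_ifs <;> simp
  have hAsingle : ∀ c, c ≠ k → A (Pi.single c 1) = Pi.single c 1 := by
    intro c hc
    funext c'
    rw [hA]
    split_ifs with h
    · subst h
      rw [Pi.single_eq_of_ne hc.symm]
    · rfl
  have hAB : T.compLinearMap A = T.compLinearMap (B ∘ₗ P) := by
    refine Module.Basis.ext_alternating (Pi.basisFun S (Fin n)) fun b _ => ?_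
    rw [AlternatingMap.compLinearMap_apply, AlternatingMap.compLinearMap_apply]
    simp only [Pi.basisFun_apply, LinearMap.comp_apply]
    by_cases hb : ∀ s, (b s : ℕ) < m
    · congr 1
      funext s c
      rw [hAsingle _ (by rintro h; have := hb s; rw [h] at this; omega), hBP]
      split_ifs with hc
      · rfl
      · rw [Pi.single_eq_of_ne]
        rintro rfl
        exact hc (hb s)
    · push Not at hb
      obtain ⟨s, hs⟩ := hb
      have h1 : B (P (Pi.single (b s) 1)) = 0 := by
        funext c
        rw [hBP, Pi.zero_apply]
        split_ifs with hc
        · rw [Pi.single_eq_of_ne]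
          rintro rfl
          omega
        · rfl
      refine Eq.trans ?_ (T.map_coord_zero (m := fun s => B (P (Pi.single (b s) 1))) s h1).symm
      rcases eq_or_ne (b s) k with hk | hk
      · refine T.map_coord_zero s ?_
        funext c
        rw [hA, hk, Pi.zero_apply]
        split_ifs with hc
        · rfl
        · rw [Pi.single_eq_of_ne hc]
      · have h2 : I.index k ≤ I.index (b s) := by
          rw [Fin.le_def]
          by_contra h3
          have := (lt_sizeUpTo_iff I (b s) _).2 (not_le.1 h3)
          omega
        have h3 := altForm_killVar_update hw hk h2
          (fun s => A (Pi.single (b s) 1)) (fun t => by rw [hA, if_pos rfl]) s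
        rw [← hAsingle _ hk, Function.update_eq_self] at h3
        exact h3
  let ρ : ℕ → Fin n → S := fun e c => killVar k (frobVec F e c)
  have hρ : ∀ e, A (ρ e) = ρ e := by
    intro e
    funext c
    rw [hA]
    split_ifs with hc
    · subst hc
      simp only [ρ, frobVec]
      rw [map_pow, killVar_X_self, zero_pow (pow_ne_zero _ Fintype.card_ne_zero)]
    · rfl
  have hval : ∀ a : Fin j → ℕ, killVar k (frobVal a w) =
      T.compLinearMap B fun s => P (ρ (a s)) := by
    intro a
    have h1 := DFunLike.congr_fun hAB fun s => ρ (a s)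
    rw [AlternatingMap.compLinearMap_apply, AlternatingMap.compLinearMap_apply] at h1
    simp only [hρ] at h1
    rw [map_frobVal]
    exact h1
  have hTB : T.compLinearMap B = 0 := by
    refine alternatingMap_eq_zero (moore F (lowX F I (I.index k))) ?_ _ fun b hb => ?_
    · rw [det_moore]
      exact prodL_lowX_ne_zero _
    · have h1 : (fun s => moore F (lowX F I (I.index k)) (b s)) =
          fun s => P (ρ ((b s : ℕ))) := by
        funext s c
        have hc : Fin.castLE hmn c ≠ k := by
          intro h
          have h1 : (c : ℕ) = k := congrArg Fin.val h
          have h2 := c.2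
          omega
        change _ = killVar k (frobVec F (b s : ℕ) (Fin.castLE hmn c))
        rw [frobVec, map_pow, killVar_X_of_ne hc]
        rfl
      rw [h1, ← hval fun s => (b s : ℕ), h0 j (fun s => (b s : ℕ)) hb fun t => (b t).2, map_zero]
  apply X_dvd_of_killVar_eq_zero
  rw [hval, hTB, AlternatingMap.zero_apply]

/-- The variable `x_k` is mapped to any linear form with leading term `x_k` by an upper unitriangular
matrix, which belongs to `K_I`. -/
theorem exists_mem_groupK_linForm (p : Σ k : Fin n, (Fin k → F)) :
    ∃ g ∈ groupK F I, symAct g (MvPolynomial.X p.1) = linForm F p := by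
  let M : Matrix (Fin n) (Fin n) F := Matrix.of fun r c => if c = p.1 then linCoeff F p r else
    (1 : Matrix (Fin n) (Fin n) F) r c
  have hdiag : ∀ r, M r r = 1 := by
    intro r
    simp only [M, Matrix.of_apply]
    split_ifs with h
    · rw [h, linCoeff_self]
    · simp
  have hlow : ∀ r c, c < r → M r c = 0 := by
    intro r c h
    simp only [M, Matrix.of_apply]
    split_ifs with h'
    · exact linCoeff_gt F p r (h' ▸ h)
    · exact Matrix.one_apply_ne h.ne'
  have hdet : M.det = 1 := by
    rw [Matrix.det_of_isUpperTriangular fun r c h => hlow r c h]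
    simp [hdiag]
  refine ⟨Matrix.GeneralLinearGroup.mkOfDetNeZero M (by rw [hdet]; exact one_ne_zero),
    ⟨?_, fun i => ?_⟩, ?_⟩
  · change M.BlockTriangular I.index
    intro r c h
    refine hlow r c ?_
    by_contra h'
    have h1 := (lt_sizeUpTo_iff I c (I.index r)).2 h
    have h2 := I.sizeUpTo_index_le r
    have h3 : (r : ℕ) ≤ c := not_lt.1 h'
    omega
  · change (M.submatrix (I.embedding i) (I.embedding i)).det = 1
    rw [Matrix.det_of_isUpperTriangular]
    · simp [hdiag]
    · intro r c h
      exact hlow _ _ ((I.embedding i).strictMono h)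
  · rw [symAct_X, linForm_eq]
    change ∑ r, M r p.1 • _ = _
    simp [M]

/-- Unipotent elements of `K_I` move `x_k` to each linear form with leading term `x_k`, so that
invariants divisible by the variables of the first blocks are divisible by all their linear forms. -/
theorem prodL_lowX_dvd {f : MvPolynomial (Fin n) F} (hf : f ∈ symInv (groupK F I)) (i : ℕ)
    (h : ∀ k : Fin n, (k : ℕ) < I.sizeUpTo i → MvPolynomial.X k ∣ f) :
    prodL F (lowX F I i) ∣ f := by
  let e : (Σ k : Fin (I.sizeUpTo i), (Fin k → F)) → Σ k : Fin n, (Fin k → F) :=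
    fun p => ⟨Fin.castLE (I.sizeUpTo_le i) p.1, p.2⟩
  have he : Function.Injective e := by
    rintro ⟨k, c⟩ ⟨k', c'⟩ h
    obtain ⟨h1, h2⟩ := Sigma.mk.inj h
    obtain rfl : k = k' := Fin.castLE_injective _ h1
    obtain rfl := eq_of_heq h2
    rfl
  have h1 : prodL F (lowX F I i) = ∏ p, linForm F (e p) := by
    rw [Fintype.prod_sigma]
    rfl
  rw [h1]
  refine Fintype.prod_dvd_of_isRelPrime (fun p p' hne => linForm_isRelPrime F _ _ (he.ne hne))
    fun p => ?_
  obtain ⟨g, hg, hgp⟩ := exists_mem_groupK_linForm (I := I) (e p)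
  rw [← hgp, ← hf g hg]
  exact map_dvd (symAct g) (h _ p.1.2)

/-- The divisibility that makes the coefficients of Mui's elements polynomials. -/
theorem prodL_lowX_dvd_frobVal {w : SymExt F n} (hw : w ∈ symExtInv (groupK F I)) (i : ℕ)
    (h0 : ∀ j (a : Fin j → ℕ), StrictMono a → (∀ t, a t < I.sizeUpTo i) → frobVal a w = 0)
    {j : ℕ} (a : Fin j → ℕ) : prodL F (lowX F I (i + 1)) ∣ frobVal a w := by
  refine prodL_lowX_dvd (frobVal_mem_symInv hw a) (i + 1) fun k hk => ?_
  refine X_dvd_frobVal hw k (fun j a ha h => h0 j a ha fun t => (h t).trans_le ?_) a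
  rw [lt_sizeUpTo_iff] at hk
  exact I.monotone_sizeUpTo (by omega)

end Divisibility

/-! ### The basis of the invariant forms -/

section Basis

variable {F : Type*} [Field F] [Fintype F] {n : ℕ} {I : Composition n}

theorem MuiIndex.b_lt (d : MuiIndex I) (t : Fin d.j) : d.b t < n :=
  (d.lt_size t).trans_le (I.sizeUpTo_le _)

/-- The block `i` of an index is determined by the largest exponent `b_j`. -/
theorem MuiIndex.ext_of_b {d d' : MuiIndex I} (hj : d.j = d'.j) (hb : HEq d.b d'.b) : d = d' := by
  obtain ⟨i, j, h1, h2, b, h3, h4, h5⟩ := d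
  obtain ⟨i', j', h1', h2', b', h3', h4', h5'⟩ := d'
  obtain rfl : j = j' := hj
  obtain rfl : b = b' := eq_of_heq hb
  have h6 := h4 ⟨j - 1, Nat.sub_lt h1 Nat.one_pos⟩
  have h7 := h4' ⟨j - 1, Nat.sub_lt h1 Nat.one_pos⟩
  have h8 : (i : ℕ) = i' := by
    by_contra hne
    rcases lt_or_gt_of_ne hne with h | h
    · have := I.monotone_sizeUpTo (show (i : ℕ) + 1 ≤ i' from h)
      omega
    · have := I.monotone_sizeUpTo (show (i' : ℕ) + 1 ≤ i from h)
      omega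
  obtain rfl : i = i' := Fin.ext h8
  rfl

instance : Finite (MuiIndex I) := by
  have hj : ∀ d : MuiIndex I, d.j < n + 1 := fun d =>
    Nat.lt_succ_of_le (d.le_size.trans (I.sizeUpTo_le _))
  refine Finite.of_injective (β := Σ j : Fin (n + 1), (Fin j → Fin n))
    (fun d => ⟨⟨d.j, hj d⟩, fun t => ⟨d.b t, d.b_lt t⟩⟩) fun d d' h => ?_
  obtain ⟨h1, h2⟩ := Sigma.mk.inj h
  have h1 : d.j = d'.j := congrArg Fin.val h1
  refine MuiIndex.ext_of_b h1 ?_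
  obtain ⟨i, j, _, _, b, _, _, _⟩ := d
  obtain ⟨i', j', _, _, b', _, _, _⟩ := d'
  obtain rfl : j = j' := h1
  refine heq_of_eq (funext fun t => ?_)
  exact congrArg Fin.val (congrFun (eq_of_heq h2) t)

/-- Duality: the value of the element of index `d'` at the exponents of an index `d ≠ d'` in the same
or a preceding block is zero. -/
theorem frobVal_muiElement_of_ne {d d' : MuiIndex I} (hi : d.i ≤ d'.i) (hne : d ≠ d') :
    frobVal d.b (muiElement F d') = 0 := by
  by_cases hj : d'.j = d.j
  · have hlt : ∀ t, d.b t < I.sizeUpTo (d'.i + 1) := fun t =>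
      (d.lt_size t).trans_le (I.monotone_sizeUpTo (Nat.succ_le_succ hi))
    have hne' : ¬ HEq d.b d'.b := fun h => hne (MuiIndex.ext_of_b hj.symm h)
    obtain ⟨i, j, _, _, b, hb, _, _⟩ := d
    obtain ⟨i', j', _, hs, b', hb', hlt', _⟩ := d'
    obtain rfl : j' = j := hj
    exact frobVal_mui_of_ne _ hs hb hb' hlt hlt' fun h => hne' (heq_of_eq h)
  · exact evalAt_mui_of_ne _ _ d'.le_size _ hj _

/-- The element of index `d` vanishes at exponents that all precede its block. -/
theorem frobVal_muiElement_of_lt {d : MuiIndex I} {j : ℕ} {a : Fin j → ℕ} (ha : StrictMono a)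
    (h : ∀ t, a t < I.sizeUpTo d.i) : frobVal a (muiElement F d) = 0 := by
  by_cases hj : d.j = j
  · obtain ⟨i, j', h1, hs, b, hb, hlt, hle⟩ := d
    obtain rfl : j' = j := hj
    refine frobVal_mui_of_ne _ hs ha hb
      (fun t => (h t).trans_le (I.monotone_sizeUpTo (Nat.le_succ _))) hlt ?_
    rintro rfl
    exact absurd (h ⟨j' - 1, Nat.sub_lt h1 Nat.one_pos⟩) (not_lt.2 hle)
  · exact evalAt_mui_of_ne _ _ d.le_size _ hj _

theorem frobVal_muiElement_self (d : MuiIndex I) : ∃ ε : ℤˣ, frobVal d.b (muiElement F d) =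
    ((ε : ℤ) : MvPolynomial (Fin n) F) * prodL F (lowX F I (d.i + 1)) :=
  frobVal_mui_self _ d.le_size d.strictMono d.lt_size

variable (F I) in
/-- The proposed basis: `1` and Mui's elements. -/
def basisVec : Option (MuiIndex I) → symExtInv (groupK F I)
  | none => ⟨1, fun g _ => map_one (symExtAct g)⟩
  | some d => ⟨muiElement F d, muiElement_mem_symExtInv d⟩

theorem frobVal_coe_smul {j : ℕ} (a : Fin j → ℕ) (f : symInv (groupK F I))
    (w : symExtInv (groupK F I)) : frobVal a ((f • w : symExtInv (groupK F I)) : SymExt F n) =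
      (f : MvPolynomial (Fin n) F) * frobVal a (w : SymExt F n) := by
  have h : ((f • w : symExtInv (groupK F I)) : SymExt F n) =
    (f : MvPolynomial (Fin n) F) • (w : SymExt F n) := rfl
  rw [h, frobVal_smul]

/-- The values of a vanishing linear combination at the exponents `d.b` involve, by duality, only the
coefficients of index `d` and of the preceding blocks, so all coefficients vanish by induction on the
blocks. -/
theorem linearIndependent_basisVec :
    LinearIndependent (symInv (groupK F I)) (basisVec F I) := by
  classical
  have := Fintype.ofFinite (MuiIndex I)
  refine Fintype.linearIndependent_iffₛ.2 fun f g hfg => ?_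
  set p : Option (MuiIndex I) → symInv (groupK F I) := fun o => f o - g o with hp
  have key : ∀ {j : ℕ} (a : Fin j → ℕ), ∑ o, (p o : MvPolynomial (Fin n) F) *
      frobVal a (basisVec F I o : SymExt F n) = 0 := by
    intro j a
    have h := congrArg (fun w : symExtInv (groupK F I) => frobVal a (w : SymExt F n)) hfg
    simp only [Submodule.coe_sum, map_sum, frobVal_coe_smul] at h
    simp only [hp, AddSubgroupClass.coe_sub, sub_mul, Finset.sum_sub_distrib]
    exact sub_eq_zero.2 h
  have hnone : p none = 0 := by
    have h := key (Fin.elim0 : Fin 0 → ℕ)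
    rw [Fintype.sum_option, Finset.sum_eq_zero fun d _ => ?_, add_zero] at h
    · change (p none : MvPolynomial (Fin n) F) * frobVal _ (1 : SymExt F n) = 0 at h
      rw [frobVal_one_of_zero, mul_one] at h
      exact Subtype.ext h
    · have h1 : frobVal (Fin.elim0 : Fin 0 → ℕ) (muiElement F d) = 0 :=
        evalAt_mui_of_ne _ _ d.le_size _ (Nat.one_le_iff_ne_zero.1 d.one_le) _
      exact (congrArg _ h1).trans (mul_zero _)
  have hsome : ∀ (i : ℕ) (d : MuiIndex I), (d.i : ℕ) = i → p (some d) = 0 := by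
    intro i
    induction i using Nat.strong_induction_on with
    | _ i ih =>
      rintro d rfl
      have h := key d.b
      rw [Fintype.sum_option, hnone, Finset.sum_eq_single d] at h
      · obtain ⟨ε, hε⟩ := frobVal_muiElement_self (F := F) d
        change ((0 : symInv (groupK F I)) : MvPolynomial (Fin n) F) * _ +
          (p (some d) : MvPolynomial (Fin n) F) * frobVal d.b (muiElement F d) = 0 at h
        rw [hε, ZeroMemClass.coe_zero, zero_mul, zero_add] at h
        have h1 : (((ε : ℤ) : MvPolynomial (Fin n) F) * prodL F (lowX F I (d.i + 1))) ≠ 0 := by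
          refine mul_ne_zero ?_ (prodL_lowX_ne_zero _)
          rcases Int.units_eq_one_or ε with rfl | rfl <;> simp
        exact Subtype.ext ((mul_eq_zero.1 h).resolve_right h1)
      · intro d' _ hne
        rcases lt_or_ge d'.i d.i with hlt | hge
        · rw [ih d'.i hlt d' rfl, ZeroMemClass.coe_zero, zero_mul]
        · have h1 := frobVal_muiElement_of_ne (F := F) hge hne.symm
          exact (congrArg _ h1).trans (mul_zero _)
      · simp
  rintro (_ | d)
  · exact sub_eq_zero.1 hnone
  · exact sub_eq_zero.1 (hsome _ d rfl)

/-- The values at the exponents in the `i`-th block determine the coefficients of Mui's elements for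
that block, by duality; subtracting them kills all values at exponents up to that block. -/
theorem exists_mem_span_frobVal_sub (w : symExtInv (groupK F I)) (i : ℕ) (hi : i ≤ I.length) :
    ∃ u ∈ Submodule.span (symInv (groupK F I)) (Set.range (basisVec F I)),
      ∀ j (a : Fin j → ℕ), StrictMono a → (∀ t, a t < I.sizeUpTo i) →
        frobVal a ((w - u : symExtInv (groupK F I)) : SymExt F n) = 0 := by
  classical
  have := Fintype.ofFinite (MuiIndex I)
  induction i with
  | zero =>
    refine ⟨(⟨frobVal (Fin.elim0 : Fin 0 → ℕ) (w : SymExt F n),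
      frobVal_mem_symInv w.2 _⟩ : symInv (groupK F I)) • basisVec F I none,
      Submodule.smul_mem _ _ (Submodule.subset_span ⟨_, rfl⟩), fun j a _ h => ?_⟩
    obtain rfl : j = 0 := by
      by_contra hj
      simpa using h ⟨0, Nat.pos_of_ne_zero hj⟩
    obtain rfl : a = Fin.elim0 := Subsingleton.elim _ _
    rw [Submodule.coe_sub, map_sub, frobVal_coe_smul, sub_eq_zero]
    have h1 : frobVal (Fin.elim0 : Fin 0 → ℕ) (basisVec F I none : SymExt F n) = 1 :=
      frobVal_one_of_zero _
    rw [h1, mul_one]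
  | succ i ih =>
    obtain ⟨u, hu, h0⟩ := ih (by omega)
    have hcoeff : ∀ d : MuiIndex I, ∃ h : symInv (groupK F I), ((d.i : ℕ) = i →
        frobVal d.b ((w - u : symExtInv (groupK F I)) : SymExt F n) =
          (h : MvPolynomial (Fin n) F) * frobVal d.b (muiElement F d)) ∧
        ((d.i : ℕ) ≠ i → h = 0) := by
      intro d
      by_cases hd : (d.i : ℕ) = i
      · obtain ⟨ε, hε⟩ := frobVal_muiElement_self (F := F) d
        obtain ⟨f, hf⟩ := prodL_lowX_dvd_frobVal (w - u).2 i h0 d.b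
        have hfinv : f ∈ symInv (groupK F I) := by
          intro g hg
          have h1 := frobVal_mem_symInv (w - u).2 d.b g hg
          rw [hf, map_mul, prodL_lowX_mem_symInv (i + 1) hi g hg] at h1
          exact mul_left_cancel₀ (prodL_lowX_ne_zero _) h1
        refine ⟨((ε : ℤ) : symInv (groupK F I)) * ⟨f, hfinv⟩, fun _ => ?_, fun h => absurd hd h⟩
        rw [hf, hε, hd]
        have h2 : (((ε : ℤ) : symInv (groupK F I)) : MvPolynomial (Fin n) F) =
            ((ε : ℤ) : MvPolynomial (Fin n) F) := by norm_cast
        rw [MulMemClass.coe_mul, h2]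
        rcases Int.units_eq_one_or ε with rfl | rfl
        · simp [mul_comm]
        · simp [mul_comm]
      · exact ⟨0, fun h => absurd h hd, fun _ => rfl⟩
    choose h hh hh0 using hcoeff
    refine ⟨u + ∑ d, h d • basisVec F I (some d), Submodule.add_mem _ hu (Submodule.sum_mem _
      fun d _ => Submodule.smul_mem _ _ (Submodule.subset_span ⟨_, rfl⟩)), fun j a ha hlt => ?_⟩
    rw [sub_add_eq_sub_sub w u, Submodule.coe_sub, map_sub, Submodule.coe_sum, map_sum]
    simp only [frobVal_coe_smul]
    have hbv : ∀ d, (basisVec F I (some d) : SymExt F n) = muiElement F d := fun _ => rfl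
    simp only [hbv]
    by_cases hlow : ∀ t, a t < I.sizeUpTo i
    · rw [h0 j a ha hlow, Finset.sum_eq_zero, sub_zero]
      intro d _
      by_cases hd : (d.i : ℕ) = i
      · rw [frobVal_muiElement_of_lt ha (by rwa [hd]), mul_zero]
      · rw [hh0 d hd, ZeroMemClass.coe_zero, zero_mul]
    · -- otherwise `a` is the list of exponents of an index `d` for the block `i`
      push Not at hlow
      obtain ⟨t, ht⟩ := hlow
      have hj : 1 ≤ j := t.pos
      have hjs : j ≤ I.sizeUpTo (i + 1) := by
        have := Fintype.card_le_of_injective (fun t => (⟨a t, hlt t⟩ : Fin (I.sizeUpTo (i + 1))))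
          fun t t' h => ha.injective (congrArg Fin.val h)
        simpa using this
      have hlast : I.sizeUpTo i ≤ a ⟨j - 1, Nat.sub_lt hj Nat.one_pos⟩ :=
        ht.trans (ha.monotone (Fin.le_def.2 (by have := t.2; simp only; omega)))
      let d : MuiIndex I := ⟨⟨i, hi⟩, j, hj, hjs, a, ha, hlt, hlast⟩
      rw [Finset.sum_eq_single d, sub_eq_zero]
      · exact hh d rfl
      · intro d' _ hne
        by_cases hd : (d'.i : ℕ) = i
        · have h1 := frobVal_muiElement_of_ne (F := F) (d := d) (d' := d')
            (Fin.le_def.2 hd.ge) hne.symm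
          rw [h1, mul_zero]
        · rw [hh0 d' hd, ZeroMemClass.coe_zero, zero_mul]
      · simp

theorem span_basisVec :
    ⊤ ≤ Submodule.span (symInv (groupK F I)) (Set.range (basisVec F I)) := by
  intro w _
  obtain ⟨u, hu, h⟩ := exists_mem_span_frobVal_sub w I.length le_rfl
  have h1 : w - u = 0 := by
    refine Subtype.ext (eq_zero_of_frobVal_eq_zero _ fun j a ha hlt => h j a ha ?_)
    rwa [I.sizeUpTo_length]
  have h2 : w = u := sub_eq_zero.1 h1
  exact h2 ▸ hu

end Basis

end

end DicksonMui

theorem theorem2p6 (F : Type*) [Field F] [Fintype F] (n : ℕ) (I : Composition n) :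
    (AlgebraicIndependent F (DicksonMui.generator F I) ∧
      DicksonMui.symInv (DicksonMui.groupK F I) =
        Algebra.adjoin F (Set.range (DicksonMui.generator F I))) ∧
    ∃ B : Module.Basis (Option (DicksonMui.MuiIndex I))
        (DicksonMui.symInv (DicksonMui.groupK F I))
        (DicksonMui.symExtInv (DicksonMui.groupK F I)),
      (B none : DicksonMui.SymExt F n) = 1 ∧
      ∀ d : DicksonMui.MuiIndex I,
        (B (some d) : DicksonMui.SymExt F n) = DicksonMui.muiElement F d := by
  refine ⟨⟨DicksonMui.algebraicIndependent_generator I, DicksonMui.symInv_groupK I⟩,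
    Module.Basis.mk DicksonMui.linearIndependent_basisVec DicksonMui.span_basisVec, ?_, fun d => ?_⟩
  · exact congrArg Subtype.val (Module.Basis.mk_apply DicksonMui.linearIndependent_basisVec
      DicksonMui.span_basisVec none)
  · exact congrArg Subtype.val (Module.Basis.mk_apply DicksonMui.linearIndependent_basisVec
      DicksonMui.span_basisVec (some d))
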